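/- **Setting.** $M\ge 1$ agents communicate over a fixed connected undirected graph with Laplacian matrix $\mathcal L$ and maximal degree $d_{\max}$. Let $\kappa\in(0,1]$ and $P=I_M-\frac{\kappa}{d_{\max}}\mathcal L$ ($P=1$ if $M=1$). Let $\lambda_1\ge\lambda_2\ge\dots\ge\lambda_M$ be the eigenvalues of $P$, with any orthonormal eigenvectors $\mathbf u_1,\dots,\mathbf u_M$, $\mathbf u_p=(u_p^d)_{d=1}^M$; assume $\lambda_M>-1$. Put $$\epsilon_n=\sqrt M\sum_{p=2}^M\frac{|\lambda_p|}{1-|\lambda_p|},\qquad \epsilon_c^k=M\sum_{p=1}^M\sum_{j=2}^M\frac{|\lambda_p\lambda_j|}{1-|\lambda_p\lambda_j|}\,a_{pj}(k),$$ where, with $\nu^+_{pj}=\sum_{d:\,u_p^du_j^d\ge0}u_p^du_j^d$ and $\nu^-_{pj}=\sum_{d:\,u_p^du_j^d\le0}u_p^du_j^d$, $a_{pj}(k)$ equals $\nu^+_{pj}u_p^ku_j^k$ if $\lambda_p\lambda_j\ge0$ and $u_p^ku_j^k\ge0$; $\nu^-_{pj}u_p^ku_j^k$ if $\lambda_p\lambda_j\ge0$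 and $u_p^ku_j^k<0$; and $\max\{|\nu^-_{pj}|,\nu^+_{pj}\}\,|u_p^ku_j^k|$ if $\lambda_p\lambda_j<0$. There are $N$ arms. The reward $r_i^k(t)$ at arm $i$ for agent $k$ at time $t$ has a distribution $p_i$ with mean $m_i$ that is sub-Gaussian with parameter $\sigma_g>0$: $\ln\mathbb E[e^{\beta r_i^k(t)}]\le m_i\beta+\sigma_g^2\beta^2/2$ for all $\beta\in\mathbb R$. The reward vectors $(r_i^k(t))_{i}$ are independent over agents $k$ and times $t$. At each time $t=1,2,\dots$ each agent $k$ selects an arm $i^k(t)$ and (unconstrained model) receives $r^k_{i^k(t)}(t)$, whatever the other agents do. The running consensus estimates are $\hat{\mathbf n}_i(0)=\hat{\mathbf s}_i(0)=0$, $\hat{\mathbf n}_i(t)=P(\hat{\mathbf n}_i(t-1)+\boldsymbol\xi_i(t))$ and $\hat{\mathbf s}_i(t)=P(\hat{\mathbf s}_i(t-1)+\mathbf r_i(t))$, where $\boldsymbol\xi_i(t)$ and $\mathbf r_i(t)$ have the entries $\mathbb 1\{i^k(t)=i\}$ and $r_i^k(t)\mathbb 1\{i^k(t)=i\}$, $k=1,\dots,M$.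 **Algorithm (coop-UCB2).** Let $\gamma>1$, $\eta\in(0,4)$, $G(\eta)=1-\eta^2/16$, and let $f:[1,\infty)\to[0,\infty)$ be nondecreasing with $f(t)/\ln t\to0$ as $t\to\infty$. At the times $t=1,\dots,N$ every agent selects arm $t$. At every time $t>N$ each agent $k$ selects an arm $i$ that maximizes $$Q_i^k(t-1)=\frac{\hat s_i^k(t-1)}{\hat n_i^k(t-1)}+\sigma_g\sqrt{\frac{2\gamma}{G(\eta)}\cdot\frac{\hat n_i^k(t-1)+f(t-1)}{M\hat n_i^k(t-1)}\cdot\frac{\ln(t-1)}{\hat n_i^k(t-1)}}\,,$$ ties being broken by any rule that depends only on rewards at times before $t$. **Regret and constant.** Let $\Delta_i=\max_jm_j-m_i$ and let $R(T)=MT\max_jm_j-\mathbb E\big[\sum_{t=1}^T\sum_{k=1}^Mm_{i^k(t)}\big]$ be the expected cumulative group regret. Assume that $f$ reaches the level $\epsilon_c^k$ for every $k$, and let $t_k^\dagger=\inf\{t\ge1: f(t)\ge\epsilon_c^k\}$ (so $t_k^\dagger=f^{-1}(\epsilon_c^k)$ when $f$ is strictly increasing and takes this value on $[1,\infty)$).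 Put $$L=\sum_{k=1}^M(t_k^\dagger-1)+M(1+\epsilon_n)+1+\frac{2M}{\ln(1+\eta)}\left(\frac1{(\gamma-1)^2}+\frac{\gamma\ln\big((1+\epsilon_n)(1+\eta)\big)}{\gamma-1}+1\right),$$ which does not depend on $T$. **Claim.** For every $T\ge1$, $$R(T)\le\sum_{i:\,\Delta_i>0}\frac{4\sigma_g^2\gamma\ln T}{\Delta_iG(\eta)}\left(1+\sqrt{1+\frac{\Delta_i^2MG(\eta)}{2\gamma\sigma_g^2}\,\frac{f(T)}{\ln T}}\right)+\sum_{i=1}^NL\,\Delta_i$$ (for $T=1$ the first sum is read as its limit value $0$). Consequently $R(T)=O(\ln T)$ as $T\to\infty$, with a leading coefficient that does not depend on the graph: for every $\delta>0$ and all sufficiently large $T$, $$R(T)\le\Big(\sum_{i:\,\Delta_i>0}\frac{8\sigma_g^2\gamma}{\Delta_iG(\eta)}+\delta\Big)\ln T .$$ -/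

import Mathlib

open MeasureTheory ProbabilityTheory Filter Asymptotics
open scoped Topology Matrix

namespace CoopUCB

/-! ### Communication graph and consensus matrix -/

/-- The consensus matrix `P = I - (κ / d_max) L`, where `L` is the graph Laplacian.
(For a single agent `L = 0`, so `P = I`.) -/
noncomputable def consensusMatrix {M : ℕ} (G : SimpleGraph (Fin M)) [DecidableRel G.Adj] (κ : ℝ) :
    Matrix (Fin M) (Fin M) ℝ :=
  1 - (κ / (G.maxDegree : ℝ)) • G.lapMatrix ℝ

/-- `lam 0 ≥ lam 1 ≥ …` are the eigenvalues of `P`, listed with multiplicity, and `u 0, u 1, …` is an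
orthonormal basis of corresponding eigenvectors; `u p d` is the `d`-th entry of `u p`. -/
structure IsOrderedEigenbasis {M : ℕ} (P : Matrix (Fin M) (Fin M) ℝ)
    (lam : Fin M → ℝ) (u : Fin M → Fin M → ℝ) : Prop where
  antitone : Antitone lam
  eigen : ∀ p, P *ᵥ u p = lam p • u p
  orthonormal : ∀ p j, u p ⬝ᵥ u j = if p = j then 1 else 0

/-- The graph explore-exploit index `ε_n = √M ∑_{p ≥ 2} |λ_p| / (1 - |λ_p|)`
(indices here start at `0`). -/
noncomputable def epsN {M : ℕ} (lam : Fin M → ℝ) : ℝ :=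
  √(M : ℝ) * ∑ p : Fin M with 0 < p.val, |lam p| / (1 - |lam p|)

/-- The sum of the nonnegative products `u_p^d u_j^d`. -/
noncomputable def nuPos {M : ℕ} (u : Fin M → Fin M → ℝ) (p j : Fin M) : ℝ :=
  ∑ d : Fin M with 0 ≤ u p d * u j d, u p d * u j d

/-- The sum of the nonpositive products `u_p^d u_j^d`. -/
noncomputable def nuNeg {M : ℕ} (u : Fin M → Fin M → ℝ) (p j : Fin M) : ℝ :=
  ∑ d : Fin M with u p d * u j d ≤ 0, u p d * u j d

/-- The coefficients `a_{pj}(k)`. -/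
noncomputable def aCoef {M : ℕ} (lam : Fin M → ℝ) (u : Fin M → Fin M → ℝ) (k p j : Fin M) : ℝ :=
  if 0 ≤ lam p * lam j then
    if 0 ≤ u p k * u j k then nuPos u p j * (u p k * u j k) else nuNeg u p j * (u p k * u j k)
  else max |nuNeg u p j| (nuPos u p j) * |u p k * u j k|

/-- The nodal explore-exploit centrality index
`ε_c^k = M ∑_{p ≥ 1} ∑_{j ≥ 2} |λ_p λ_j| / (1 - |λ_p λ_j|) a_{pj}(k)` (indices here start at `0`). -/
noncomputable def epsC {M : ℕ} (lam : Fin M → ℝ) (u : Fin M → Fin M → ℝ) (k : Fin M) : ℝ :=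
  (M : ℝ) * ∑ p : Fin M, ∑ j : Fin M with 0 < j.val,
    |lam p * lam j| / (1 - |lam p * lam j|) * aCoef lam u k p j

/-! ### Rewards -/

/-- The distribution `p` on `ℝ` is sub-Gaussian with parameter `σ`: its cumulant generating function
`φ` is finite and `φ(β) ≤ m β + σ² β² / 2` for all real `β`, where `m` is the mean of `p`. -/
def IsSubGaussian (p : Measure ℝ) (σ : ℝ) : Prop :=
  Integrable id p ∧ ∀ β : ℝ, Integrable (fun x => Real.exp (β * x)) p ∧
    cgf id p β ≤ (∫ x, x ∂p) * β + σ ^ 2 * β ^ 2 / 2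

/-- `r t k i` is the realized reward at arm `i` for agent `k` at time `t`. It has law `p i`, and
rewards of different agents or at different times are independent. (No independence is required
between the rewards of different arms for one agent at one time.) -/
structure IsRewardProcess {M N : ℕ} {Ω : Type*} [MeasurableSpace Ω] (μ : Measure Ω)
    (p : Fin N → Measure ℝ) (r : ℕ → Fin M → Fin N → Ω → ℝ) : Prop where
  measurable : ∀ t k i, Measurable (r t k i)
  law : ∀ t k i, HasLaw (r t k i) (p i) μ
  indep : iIndepFun (fun (q : ℕ × Fin M) (ω : Ω) (i : Fin N) => r q.1 q.2 i ω) μ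

/-- The σ-algebra `𝓕_{t-1}` generated by all rewards at the times `1, …, t - 1`. -/
@[reducible] def pastRewards {M N : ℕ} {Ω : Type*} (r : ℕ → Fin M → Fin N → Ω → ℝ) (t : ℕ) :
    MeasurableSpace Ω :=
  ⨆ s ∈ Set.Ico 1 t, ⨆ (k : Fin M) (i : Fin N), MeasurableSpace.comap (r s k i) inferInstance

/-! ### Cooperative estimation, along one realization
`a t k` is the arm selected by agent `k` at time `t`, and `y t k i` the reward at arm `i`
for agent `k` at time `t`. -/

/-- Running consensus for the number of selections of arm `i`:
`n̂_i(0) = 0` and `n̂_i(t) = P (n̂_i(t-1) + ξ_i(t))`. -/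
noncomputable def nHat {M N : ℕ} (P : Matrix (Fin M) (Fin M) ℝ) (a : ℕ → Fin M → Fin N)
    (i : Fin N) : ℕ → Fin M → ℝ
  | 0 => 0
  | t + 1 => P *ᵥ (nHat P a i t + fun k => if a (t + 1) k = i then 1 else 0)

/-- Running consensus for the total reward at arm `i`:
`ŝ_i(0) = 0` and `ŝ_i(t) = P (ŝ_i(t-1) + r_i(t))`. -/
noncomputable def sHat {M N : ℕ} (P : Matrix (Fin M) (Fin M) ℝ) (a : ℕ → Fin M → Fin N)
    (y : ℕ → Fin M → Fin N → ℝ) (i : Fin N) : ℕ → Fin M → ℝ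
  | 0 => 0
  | t + 1 => P *ᵥ (sHat P a y i t + fun k => if a (t + 1) k = i then y (t + 1) k i else 0)

/-! ### The coop-UCB2 algorithm -/

/-- `G(η) = 1 - η² / 16`. -/
noncomputable def gFun (η : ℝ) : ℝ := 1 - η ^ 2 / 16

/-- The exploration term `C_i^k(t)`, as a function of `n = n̂_i^k(t)`. -/
noncomputable def explore (M : ℕ) (σ γ η : ℝ) (f : ℝ → ℝ) (t : ℕ) (n : ℝ) : ℝ :=
  σ * √(2 * γ / gFun η * ((n + f t) / (M * n)) * (Real.log t / n))

/-- The heuristic `Q_i^k(t) = ŝ_i^k(t) / n̂_i^k(t) + C_i^k(t)`. -/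
noncomputable def qIndex {M N : ℕ} (P : Matrix (Fin M) (Fin M) ℝ) (σ γ η : ℝ) (f : ℝ → ℝ)
    (a : ℕ → Fin M → Fin N) (y : ℕ → Fin M → Fin N → ℝ) (t : ℕ) (k : Fin M) (i : Fin N) : ℝ :=
  sHat P a y i t k / nHat P a i t k + explore M σ γ η f t (nHat P a i t k)

/-- `arm t k` is the arm selected by agent `k` at time `t` when all agents run coop-UCB2: each agent
first samples the arms one after the other, at the times `1, …, N`, and at every time `t + 1 > N` it
selects an arm that maximizes `Q_i^k(t)`. Ties may be broken by any rule that uses only the past. -/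
structure IsCoopUCB2 {M N : ℕ} {Ω : Type*} (P : Matrix (Fin M) (Fin M) ℝ) (σ γ η : ℝ) (f : ℝ → ℝ)
    (r : ℕ → Fin M → Fin N → Ω → ℝ) (arm : ℕ → Fin M → Ω → Fin N) : Prop where
  init : ∀ (i : Fin N) (k : Fin M) (ω : Ω), arm (i.val + 1) k ω = i
  select : ∀ t : ℕ, N ≤ t → ∀ (k : Fin M) (ω : Ω) (i : Fin N),
    qIndex P σ γ η f (fun s j => arm s j ω) (fun s j l => r s j l ω) t k i ≤
      qIndex P σ γ η f (fun s j => arm s j ω) (fun s j l => r s j l ω) t k (arm (t + 1) k ω)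
  previsible : ∀ t : ℕ, 1 ≤ t → ∀ k : Fin M, Measurable[pastRewards r t] (arm t k)

/-! ### Regret and its bound -/

/-- The gap `Δ_i = max_j m_j - m_i`. -/
noncomputable def gap {N : ℕ} (m : Fin N → ℝ) (i : Fin N) : ℝ := (⨆ j, m j) - m i

/-- The expected cumulative group regret until time `T` under the unconstrained reward model,
`M T max_j m_j - 𝔼[∑_{t ≤ T} ∑_k m_{i^k(t)}]`. -/
noncomputable def regretUnc {M N : ℕ} {Ω : Type*} [MeasurableSpace Ω] (μ : Measure Ω)
    (m : Fin N → ℝ) (arm : ℕ → Fin M → Ω → Fin N) (T : ℕ) : ℝ :=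
  (M : ℝ) * T * (⨆ j, m j) - ∫ ω, ∑ t ∈ Finset.Icc 1 T, ∑ k, m (arm t k ω) ∂μ

/-- The first time in `[1, ∞)` at which `f` reaches the level `ε`; it is `f⁻¹(ε)` if `f` is strictly
increasing on `[1, ∞)` and takes the value `ε` there. -/
noncomputable def reachTime (f : ℝ → ℝ) (ε : ℝ) : ℝ := sInf {t : ℝ | 1 ≤ t ∧ ε ≤ f t}

/-- The constant `L(ε_n, ε_c^1, …, ε_c^M)`, with `t_k† = f⁻¹(ε_c^k)`. -/
noncomputable def constL {M : ℕ} (γ η : ℝ) (f : ℝ → ℝ) (εn : ℝ) (εc : Fin M → ℝ) : ℝ :=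
  ∑ k, (reachTime f (εc k) - 1) + M * (1 + εn) + 1
    + 2 * M / Real.log (1 + η) *
      (1 / (γ - 1) ^ 2 + γ * Real.log ((1 + εn) * (1 + η)) / (γ - 1) + 1)

end CoopUCB

/-! Write `Δ` for the gap of a suboptimal arm `i` and `n̂`, `ŝ` for an agent's consensus estimates
of it. If the agent selects `i` although `n̂` is above the threshold where the exploration term
drops below `Δ / 2`, then `ŝ / n̂` misses the mean by more than the exploration term, for arm `i` or
for an optimal arm.

Such a deviation is rare. By the spectral theorem both estimates are sums over the past of rewards
with weights `(P ^ τ) k d`, and the squared weights of the selected rewards add up to at most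
`(n̂ + ε_c^k) / M`, which is at most `(n̂ + f t) / M` once `f t ≥ ε_c^k`. Selections are previsible,
so the exponential of the weighted noise minus this variance proxy has mean at most one, and
splitting the range `1 ≤ n̂ ≤ t` into `log t / log (1 + η)` geometric slices gives probability
`O(log t * t ^ (-γ))`, which is summable.

Finally `|n̂ - selections / M| ≤ ε_n` converts the threshold for `n̂` into a bound on the selections
of the whole group. -/

namespace CoopUCB

/-! ### Spectral decomposition of the consensus matrix -/

section Spectral

variable {M : ℕ} {P : Matrix (Fin M) (Fin M) ℝ} {lam : Fin M → ℝ} {u : Fin M → Fin M → ℝ}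

theorem IsOrderedEigenbasis.completeness (h : IsOrderedEigenbasis P lam u) (d e : Fin M) :
    ∑ p, u p d * u p e = if d = e then 1 else 0 := by
  have rows_orthonormal : Matrix.of u * (Matrix.of u)ᵀ = 1 := by
    ext p j
    simpa [Matrix.mul_apply, Matrix.one_apply, dotProduct] using h.orthonormal p j
  have columns_orthonormal : (Matrix.of u)ᵀ * Matrix.of u = 1 :=
    mul_eq_one_comm.mp rows_orthonormal
  simpa [Matrix.mul_apply, Matrix.one_apply] using congrFun₂ columns_orthonormal d e

theorem IsOrderedEigenbasis.pow_mulVec (h : IsOrderedEigenbasis P lam u) (τ : ℕ) (p : Fin M) :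
    (P ^ τ) *ᵥ u p = lam p ^ τ • u p := by
  induction τ with
  | zero => simp
  | succ τ ih =>
    rw [pow_succ, ← Matrix.mulVec_mulVec, h.eigen, Matrix.mulVec_smul, ih, smul_smul, pow_succ,
      mul_comm]

theorem IsOrderedEigenbasis.pow_apply (h : IsOrderedEigenbasis P lam u) (τ : ℕ) (k d : Fin M) :
    (P ^ τ) k d = ∑ p, lam p ^ τ * (u p k * u p d) := by
  have eigen : ∀ p, ∑ e, (P ^ τ) k e * u p e = lam p ^ τ * u p k := fun p ↦ by
    simpa [Matrix.mulVec, dotProduct] using congrFun (h.pow_mulVec τ p) k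
  calc (P ^ τ) k d = ∑ e, (P ^ τ) k e * ∑ p, u p e * u p d := by simp [h.completeness]
    _ = ∑ p, (∑ e, (P ^ τ) k e * u p e) * u p d := by
        simp only [Finset.mul_sum, Finset.sum_mul, mul_assoc]
        exact Finset.sum_comm
    _ = ∑ p, lam p ^ τ * (u p k * u p d) := by simp only [eigen, mul_assoc]

theorem IsOrderedEigenbasis.isSymm (h : IsOrderedEigenbasis P lam u) : P.IsSymm :=
  Matrix.IsSymm.ext fun k d ↦ by
    rw [← pow_one P, h.pow_apply, h.pow_apply]
    simp only [mul_comm]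

theorem IsOrderedEigenbasis.sum_sq (h : IsOrderedEigenbasis P lam u) (p : Fin M) :
    ∑ d, u p d ^ 2 = 1 := by
  simpa [dotProduct, sq] using h.orthonormal p p

theorem IsOrderedEigenbasis.abs_apply_le_one (h : IsOrderedEigenbasis P lam u) (p k : Fin M) :
    |u p k| ≤ 1 := by
  rw [← sq_le_one_iff_abs_le_one, ← h.sum_sq p]
  exact Finset.single_le_sum (f := fun d ↦ u p d ^ 2) (fun d _ ↦ sq_nonneg _) (Finset.mem_univ k)

theorem IsOrderedEigenbasis.one_dotProduct_eq_zero (h : IsOrderedEigenbasis P lam u)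
    (hP : P *ᵥ 1 = 1) {p : Fin M} (hp : lam p ≠ 1) : 1 ⬝ᵥ u p = 0 := by
  have fixed : 1 ⬝ᵥ u p = lam p * (1 ⬝ᵥ u p) := by
    rw [← smul_eq_mul, ← dotProduct_smul, ← h.eigen, Matrix.dotProduct_mulVec,
      ← Matrix.mulVec_transpose, h.isSymm.eq, hP]
  have : (1 - lam p) * (1 ⬝ᵥ u p) = 0 := by linarith
  exact (mul_eq_zero.mp this).resolve_left (sub_ne_zero.mpr hp.symm)

theorem sum_eq_add_sum_pos {p₀ : Fin M} (hp₀ : p₀.val = 0) (g : Fin M → ℝ) :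
    ∑ p, g p = g p₀ + ∑ p : Fin M with 0 < p.val, g p := by
  have : (Finset.univ.filter fun p : Fin M ↦ 0 < p.val) = Finset.univ.erase p₀ := by
    ext p
    simp [Fin.ext_iff, hp₀, Nat.pos_iff_ne_zero]
  rw [this, Finset.add_sum_erase _ _ (Finset.mem_univ p₀)]

/-- A row-stochastic matrix `P` with an orthonormal eigenbasis for which all eigenvalues except the
first have modulus less than one, so that the powers of `P` converge to averaging over the agents.
This is all that the analysis of the consensus estimates uses about the communication graph. -/
structure IsMixing (P : Matrix (Fin M) (Fin M) ℝ) (lam : Fin M → ℝ)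
    (u : Fin M → Fin M → ℝ) : Prop where
  basis : IsOrderedEigenbasis P lam u
  stochastic : P ∈ Matrix.rowStochastic ℝ (Fin M)
  abs_lam_lt_one : ∀ p : Fin M, 0 < p.val → |lam p| < 1

theorem IsMixing.one_eq_smul (h : IsMixing P lam u) {p₀ : Fin M} (hp₀ : p₀.val = 0) (d : Fin M) :
    1 = (1 ⬝ᵥ u p₀) * u p₀ d := by
  have orthogonal : ∀ p : Fin M, 0 < p.val → 1 ⬝ᵥ u p = 0 := fun p hp ↦
    h.basis.one_dotProduct_eq_zero (Matrix.one_vecMul_of_mem_rowStochastic h.stochastic)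
      fun hl ↦ by simpa [hl] using h.abs_lam_lt_one p hp
  calc (1 : ℝ) = ∑ e, ∑ p, u p e * u p d := by simp [h.basis.completeness]
    _ = ∑ p, (1 ⬝ᵥ u p) * u p d := by
        rw [Finset.sum_comm]
        simp only [dotProduct, Pi.one_apply, one_mul, Finset.sum_mul]
    _ = (1 ⬝ᵥ u p₀) * u p₀ d := by
        rw [sum_eq_add_sum_pos hp₀, Finset.sum_eq_zero, add_zero]
        intro p hp
        rw [orthogonal p (Finset.mem_filter.mp hp).2, zero_mul]

theorem IsMixing.lam_eq_one (h : IsMixing P lam u) {p₀ : Fin M} (hp₀ : p₀.val = 0) :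
    lam p₀ = 1 := by
  by_contra hne
  have := h.basis.one_dotProduct_eq_zero
    (Matrix.one_vecMul_of_mem_rowStochastic h.stochastic) hne
  simpa [this] using h.one_eq_smul hp₀ p₀

theorem IsMixing.apply_mul_apply (h : IsMixing P lam u) {p₀ : Fin M} (hp₀ : p₀.val = 0)
    (k d : Fin M) : u p₀ k * u p₀ d = 1 / M := by
  set c := 1 ⬝ᵥ u p₀
  have hc : ∀ e, 1 = c * u p₀ e := h.one_eq_smul hp₀
  have c_ne_zero : c ≠ 0 := left_ne_zero_of_mul_eq_one (hc k).symm
  have apply_eq : ∀ e, u p₀ e = 1 / c := fun e ↦ by rw [hc e]; field_simp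
  have norm_eq : (M : ℝ) * (1 / c) ^ 2 = 1 := by simpa [apply_eq] using h.basis.sum_sq p₀
  rw [apply_eq, apply_eq, eq_div_iff (left_ne_zero_of_mul_eq_one norm_eq)]
  linear_combination norm_eq

theorem IsMixing.pow_apply (h : IsMixing P lam u) (τ : ℕ) (k d : Fin M) :
    (P ^ τ) k d = 1 / M + ∑ p : Fin M with 0 < p.val, lam p ^ τ * (u p k * u p d) := by
  have hp₀ : (⟨0, k.pos⟩ : Fin M).val = 0 := rfl
  rw [h.basis.pow_apply, sum_eq_add_sum_pos hp₀, h.lam_eq_one hp₀, h.apply_mul_apply hp₀, one_pow,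
    one_mul]

theorem IsMixing.abs_lam_le_one (h : IsMixing P lam u) (p : Fin M) : |lam p| ≤ 1 := by
  obtain hp | hp := p.val.eq_zero_or_pos
  · rw [h.lam_eq_one hp, abs_one]
  · exact (h.abs_lam_lt_one p hp).le

theorem IsMixing.abs_lam_mul_lam_lt_one (h : IsMixing P lam u) (p : Fin M) {j : Fin M}
    (hj : 0 < j.val) : |lam p * lam j| < 1 := by
  rw [abs_mul]
  exact (mul_le_of_le_one_left (abs_nonneg _) (h.abs_lam_le_one p)).trans_lt
    (h.abs_lam_lt_one j hj)

end Spectral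

section Graph

variable {M : ℕ} {G : SimpleGraph (Fin M)} [DecidableRel G.Adj] {κ : ℝ}

theorem consensusMatrix_mulVec (v : Fin M → ℝ) :
    consensusMatrix G κ *ᵥ v = v - (κ / (G.maxDegree : ℝ)) • (G.lapMatrix ℝ *ᵥ v) := by
  simp [consensusMatrix, Matrix.sub_mulVec, Matrix.smul_mulVec]

theorem consensusMatrix_nonneg (hκ : κ ∈ Set.Ioc (0 : ℝ) 1) (k d : Fin M) :
    0 ≤ consensusMatrix G κ k d := by
  by_cases hkd : k = d
  · subst hkd
    have : κ / (G.maxDegree : ℝ) * G.degree k ≤ 1 := by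
      rw [div_mul_eq_mul_div]
      refine div_le_one_of_le₀ ?_ (Nat.cast_nonneg _)
      have : (G.degree k : ℝ) ≤ G.maxDegree := by exact_mod_cast G.degree_le_maxDegree k
      exact (mul_le_of_le_one_left (Nat.cast_nonneg _) hκ.2).trans this
    simpa [consensusMatrix, SimpleGraph.lapMatrix, SimpleGraph.degMatrix] using this
  · have : 0 ≤ κ / (G.maxDegree : ℝ) := div_nonneg hκ.1.le (Nat.cast_nonneg _)
    simp only [consensusMatrix, SimpleGraph.lapMatrix, SimpleGraph.degMatrix, Matrix.sub_apply,
      Matrix.smul_apply, Matrix.one_apply_ne hkd, Matrix.diagonal_apply_ne _ hkd,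
      SimpleGraph.adjMatrix_apply, smul_eq_mul]
    split_ifs <;> linarith

theorem consensusMatrix_mem_rowStochastic (hκ : κ ∈ Set.Ioc (0 : ℝ) 1) :
    consensusMatrix G κ ∈ Matrix.rowStochastic ℝ (Fin M) := by
  refine Matrix.mem_rowStochastic.mpr ⟨consensusMatrix_nonneg hκ, ?_⟩
  have : G.lapMatrix ℝ *ᵥ 1 = 0 := SimpleGraph.lapMatrix_mulVec_const_eq_zero G
  rw [consensusMatrix_mulVec, this, smul_zero, sub_zero]

variable {lam : Fin M → ℝ} {u : Fin M → Fin M → ℝ}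

theorem IsOrderedEigenbasis.lam_le_one (h : IsOrderedEigenbasis (consensusMatrix G κ) lam u)
    (hκ : 0 ≤ κ) (p : Fin M) : lam p ≤ 1 := by
  have rayleigh := congrArg (u p ⬝ᵥ ·) (h.eigen p)
  simp only [consensusMatrix_mulVec, dotProduct_sub, dotProduct_smul, h.orthonormal p p, if_true,
    smul_eq_mul, mul_one] at rayleigh
  have laplacian_nonneg : 0 ≤ u p ⬝ᵥ (G.lapMatrix ℝ *ᵥ u p) := by
    simpa using (SimpleGraph.posSemidef_lapMatrix ℝ G).dotProduct_mulVec_nonneg (u p)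
  have := mul_nonneg (div_nonneg hκ (Nat.cast_nonneg (α := ℝ) G.maxDegree)) laplacian_nonneg
  linarith

theorem IsOrderedEigenbasis.apply_eq_apply (h : IsOrderedEigenbasis (consensusMatrix G κ) lam u)
    (hG : G.Connected) (hκ : κ ≠ 0) {p : Fin M} (hp : lam p = 1) (k d : Fin M) :
    u p k = u p d := by
  obtain rfl | hkd := eq_or_ne k d
  · rfl
  have degree_pos : 0 < G.maxDegree := by
    have : Nontrivial (Fin M) := ⟨k, d, hkd⟩
    exact (hG.preconnected.degree_pos_of_nontrivial k).trans_le (G.degree_le_maxDegree k)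
  have harmonic : G.lapMatrix ℝ *ᵥ u p = 0 := by
    have := h.eigen p
    rw [consensusMatrix_mulVec, hp, one_smul, sub_eq_self] at this
    exact (smul_eq_zero.mp this).resolve_left (div_ne_zero hκ (by positivity))
  exact (SimpleGraph.lapMatrix_mulVec_eq_zero_iff_forall_reachable G).mp harmonic k d
    (hG.preconnected k d)

theorem IsOrderedEigenbasis.lam_ne_one (h : IsOrderedEigenbasis (consensusMatrix G κ) lam u)
    (hG : G.Connected) (hκ : κ ∈ Set.Ioc (0 : ℝ) 1) {p : Fin M} (hp : 0 < p.val) :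
    lam p ≠ 1 := by
  intro hl
  let p₀ : Fin M := ⟨0, p.pos⟩
  have hl₀ : lam p₀ = 1 := le_antisymm (h.lam_le_one hκ.1.le p₀)
    (hl ▸ h.antitone (Fin.le_def.mpr (Nat.zero_le _)))
  have const := h.apply_eq_apply hG hκ.1.ne' hl
  have const₀ := h.apply_eq_apply hG hκ.1.ne' hl₀
  have norm_eq := h.sum_sq p
  have norm_eq₀ := h.sum_sq p₀
  have orthogonal := h.orthonormal p₀ p
  rw [if_neg (fun e ↦ hp.ne (congrArg Fin.val e))] at orthogonal
  simp only [dotProduct, const _ p, const₀ _ p, Finset.sum_const, Finset.card_univ,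
    Fintype.card_fin, nsmul_eq_mul] at orthogonal norm_eq norm_eq₀
  refine one_ne_zero (α := ℝ) ?_
  linear_combination M * (u p₀ p * u p p) * orthogonal - M * u p p ^ 2 * norm_eq₀ - norm_eq

theorem isMixing_consensusMatrix (hG : G.Connected) (hκ : κ ∈ Set.Ioc (0 : ℝ) 1)
    (h : IsOrderedEigenbasis (consensusMatrix G κ) lam u) (hlam : ∀ p, -1 < lam p) :
    IsMixing (consensusMatrix G κ) lam u where
  basis := h
  stochastic := consensusMatrix_mem_rowStochastic hκ
  abs_lam_lt_one p hp :=
    abs_lt.mpr ⟨hlam p, (h.lam_le_one hκ.1.le p).lt_of_ne (h.lam_ne_one hG hκ hp)⟩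

end Graph

/-! ### Consensus sums and the graph indices -/

section ConsensusSum

variable {M : ℕ} {P : Matrix (Fin M) (Fin M) ℝ} {lam : Fin M → ℝ} {u : Fin M → Fin M → ℝ}

theorem sum_pow_sub_le {x : ℝ} (h0 : 0 ≤ x) (h1 : x < 1) (t : ℕ) :
    ∑ s ∈ Finset.range t, x ^ (t - s) ≤ x / (1 - x) := by
  have hx : 0 < 1 - x := sub_pos.mpr h1
  induction t with
  | zero => simpa using div_nonneg h0 hx.le
  | succ t ih =>
    have shift : ∑ s ∈ Finset.range t, x ^ (t + 1 - s)
        = x * ∑ s ∈ Finset.range t, x ^ (t - s) := by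
      rw [Finset.mul_sum]
      refine Finset.sum_congr rfl fun s hs ↦ ?_
      rw [← pow_succ', Nat.sub_add_comm (Finset.mem_range.mp hs).le]
    rw [Finset.sum_range_succ, shift, Nat.add_sub_cancel_left, pow_one]
    calc x * ∑ s ∈ Finset.range t, x ^ (t - s) + x ≤ x * (x / (1 - x)) + x := by gcongr
      _ = x / (1 - x) := by field_simp; ring

theorem IsMixing.sum_pow_apply_mul (h : IsMixing P lam u) (τ : ℕ) (k : Fin M) (ξ : Fin M → ℝ) :
    ∑ d, (P ^ τ) k d * ξ d = (∑ d, ξ d) / M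
      + ∑ p : Fin M with 0 < p.val, lam p ^ τ * (u p k * ∑ d, u p d * ξ d) := by
  simp only [h.pow_apply, add_mul, Finset.sum_mul, Finset.sum_add_distrib]
  rw [Finset.sum_comm]
  simp only [Finset.mul_sum, Finset.sum_div, mul_assoc, one_div, inv_mul_eq_div]

theorem IsOrderedEigenbasis.abs_sum_mul_le_sqrt (h : IsOrderedEigenbasis P lam u) (p : Fin M)
    {ξ : Fin M → ℝ} (hξ : ∀ d, ξ d ∈ Set.Icc (0 : ℝ) 1) : |∑ d, u p d * ξ d| ≤ √M := by
  apply Real.abs_le_sqrt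
  calc (∑ d, u p d * ξ d) ^ 2 ≤ (∑ d, u p d ^ 2) * ∑ d, ξ d ^ 2 :=
        Finset.sum_mul_sq_le_sq_mul_sq _ _ _
    _ ≤ 1 * ∑ _d : Fin M, 1 := by
        rw [h.sum_sq]
        gcongr with d
        exact pow_le_one₀ (hξ d).1 (hξ d).2
    _ = M := by simp

theorem IsMixing.mean_sub_le_sum_pow_apply_mul (h : IsMixing P lam u) (τ : ℕ) (k : Fin M)
    {ξ : Fin M → ℝ} (hξ : ∀ d, ξ d ∈ Set.Icc (0 : ℝ) 1) :
    (∑ d, ξ d) / M - ∑ p : Fin M with 0 < p.val, √M * |lam p| ^ τ ≤ ∑ d, (P ^ τ) k d * ξ d := by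
  rw [h.sum_pow_apply_mul, sub_eq_add_neg, ← Finset.sum_neg_distrib]
  gcongr with p
  refine neg_le_of_abs_le ?_
  rw [abs_mul, abs_mul, abs_pow, mul_comm]
  gcongr
  calc |u p k| * |∑ d, u p d * ξ d| ≤ 1 * √M := by
        gcongr
        · exact h.basis.abs_apply_le_one p k
        · exact h.basis.abs_sum_mul_le_sqrt p hξ
    _ = √M := one_mul _

theorem IsMixing.mean_sub_epsN_le (h : IsMixing P lam u) {ξ : ℕ → Fin M → ℝ}
    (hξ : ∀ s d, ξ s d ∈ Set.Icc (0 : ℝ) 1) (t : ℕ) (k : Fin M) :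
    (∑ s ∈ Finset.range t, ∑ d, ξ s d) / M - epsN lam ≤
      ∑ s ∈ Finset.range t, ∑ d, (P ^ (t - s)) k d * ξ s d := by
  have geometric : ∑ s ∈ Finset.range t, ∑ p : Fin M with 0 < p.val, √M * |lam p| ^ (t - s)
      ≤ epsN lam := by
    rw [Finset.sum_comm, epsN, Finset.mul_sum]
    refine Finset.sum_le_sum fun p hp ↦ ?_
    rw [← Finset.mul_sum]
    gcongr
    exact sum_pow_sub_le (abs_nonneg _) (h.abs_lam_lt_one p (Finset.mem_filter.mp hp).2) t
  have := Finset.sum_le_sum fun s (_ : s ∈ Finset.range t) ↦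
    h.mean_sub_le_sum_pow_apply_mul (t - s) k (hξ s)
  rw [Finset.sum_sub_distrib, ← Finset.sum_div] at this
  linarith

theorem IsMixing.epsN_nonneg (h : IsMixing P lam u) : 0 ≤ epsN lam :=
  mul_nonneg (Real.sqrt_nonneg _) (Finset.sum_nonneg fun p hp ↦ div_nonneg (abs_nonneg _)
    (sub_nonneg.mpr (h.abs_lam_lt_one p (Finset.mem_filter.mp hp).2).le))

section Coefficients

variable (lam : Fin M → ℝ) (u : Fin M → Fin M → ℝ) (k p j : Fin M)

theorem nuPos_nonneg : 0 ≤ nuPos u p j :=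
  Finset.sum_nonneg fun _ hd ↦ (Finset.mem_filter.mp hd).2

theorem nuNeg_nonpos : nuNeg u p j ≤ 0 :=
  Finset.sum_nonpos fun _ hd ↦ (Finset.mem_filter.mp hd).2

theorem aCoef_nonneg : 0 ≤ aCoef lam u k p j := by
  rw [aCoef]
  split_ifs with hl hk
  · exact mul_nonneg (nuPos_nonneg u p j) hk
  · exact mul_nonneg_of_nonpos_of_nonpos (nuNeg_nonpos u p j) (not_le.mp hk).le
  · exact mul_nonneg (le_max_of_le_left (abs_nonneg _)) (abs_nonneg _)

variable {ξ : Fin M → ℝ}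

theorem sum_mul_le_nuPos (hξ : ∀ d, ξ d ∈ Set.Icc (0 : ℝ) 1) :
    ∑ d, u p d * u j d * ξ d ≤ nuPos u p j := by
  rw [nuPos, Finset.sum_filter]
  refine Finset.sum_le_sum fun d _ ↦ ?_
  split_ifs with hd
  · exact mul_le_of_le_one_right hd (hξ d).2
  · exact mul_nonpos_of_nonpos_of_nonneg (not_le.mp hd).le (hξ d).1

theorem nuNeg_le_sum_mul (hξ : ∀ d, ξ d ∈ Set.Icc (0 : ℝ) 1) :
    nuNeg u p j ≤ ∑ d, u p d * u j d * ξ d := by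
  rw [nuNeg, Finset.sum_filter]
  refine Finset.sum_le_sum fun d _ ↦ ?_
  split_ifs with hd
  · exact le_mul_of_le_one_right hd (hξ d).2
  · exact mul_nonneg (not_le.mp hd).le (hξ d).1

theorem pow_mul_sum_le_pow_mul_aCoef (hξ : ∀ d, ξ d ∈ Set.Icc (0 : ℝ) 1) (τ : ℕ) :
    (lam p * lam j) ^ τ * ((u p k * u j k) * ∑ d, u p d * u j d * ξ d) ≤
      |lam p * lam j| ^ τ * aCoef lam u k p j := by
  have le_nuPos := sum_mul_le_nuPos u p j hξ
  have nuNeg_le := nuNeg_le_sum_mul u p j hξ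
  set X := ∑ d, u p d * u j d * ξ d
  rw [aCoef]
  split_ifs with hl hk
  · rw [abs_of_nonneg hl, mul_comm (u p k * u j k)]
    gcongr
  · rw [abs_of_nonneg hl, mul_comm (u p k * u j k)]
    gcongr ?_ * ?_
    exact mul_le_mul_of_nonpos_right nuNeg_le (not_le.mp hk).le
  · have abs_le : |X| ≤ max |nuNeg u p j| (nuPos u p j) := abs_le'.mpr
      ⟨le_max_of_le_right le_nuPos, le_max_of_le_left ((neg_le_neg nuNeg_le).trans (neg_le_abs _))⟩
    refine (le_abs_self _).trans ?_
    rw [abs_mul, abs_pow, abs_mul (u p k * u j k), mul_comm |u p k * u j k|]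
    gcongr

end Coefficients

theorem IsMixing.pow_apply_sq (h : IsMixing P lam u) (τ : ℕ) (k d : Fin M) :
    (P ^ τ) k d ^ 2 = (P ^ τ) k d / M + ∑ p, ∑ j : Fin M with 0 < j.val,
      (lam p * lam j) ^ τ * ((u p k * u j k) * (u p d * u j d)) := by
  calc (P ^ τ) k d ^ 2 = (P ^ τ) k d * (1 / M)
        + (P ^ τ) k d * ∑ j : Fin M with 0 < j.val, lam j ^ τ * (u j k * u j d) := by
        rw [← mul_add, ← h.pow_apply, sq]
    _ = (P ^ τ) k d / M + ∑ p, ∑ j : Fin M with 0 < j.val,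
          (lam p ^ τ * (u p k * u p d)) * (lam j ^ τ * (u j k * u j d)) := by
        rw [mul_one_div, h.basis.pow_apply, Finset.sum_mul_sum]
    _ = _ := by
        simp only [mul_pow, mul_assoc, mul_left_comm]

theorem IsMixing.sum_pow_apply_sq_mul_le (h : IsMixing P lam u) (τ : ℕ) (k : Fin M)
    {ξ : Fin M → ℝ} (hξ : ∀ d, ξ d ∈ Set.Icc (0 : ℝ) 1) :
    ∑ d, (P ^ τ) k d ^ 2 * ξ d ≤ (∑ d, (P ^ τ) k d * ξ d) / M
      + ∑ p, ∑ j : Fin M with 0 < j.val, |lam p * lam j| ^ τ * aCoef lam u k p j := by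
  calc ∑ d, (P ^ τ) k d ^ 2 * ξ d
      = (∑ d, (P ^ τ) k d * ξ d) / M + ∑ p, ∑ j : Fin M with 0 < j.val,
          (lam p * lam j) ^ τ * ((u p k * u j k) * ∑ d, u p d * u j d * ξ d) := by
        simp only [h.pow_apply_sq, add_mul, Finset.sum_add_distrib, Finset.sum_mul, Finset.sum_div,
          Finset.mul_sum, div_mul_eq_mul_div, mul_assoc]
        rw [Finset.sum_comm]
        simp only [Finset.sum_comm (s := Finset.univ) (t := Finset.filter _ _)]
    _ ≤ _ := by
        refine add_le_add le_rfl (Finset.sum_le_sum fun p _ ↦ Finset.sum_le_sum fun j _ ↦ ?_)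
        exact pow_mul_sum_le_pow_mul_aCoef lam u k p j hξ τ

theorem IsMixing.sum_sq_mul_le (h : IsMixing P lam u) {ξ : ℕ → Fin M → ℝ}
    (hξ : ∀ s d, ξ s d ∈ Set.Icc (0 : ℝ) 1) (t : ℕ) (k : Fin M) :
    ∑ s ∈ Finset.range t, ∑ d, (P ^ (t - s)) k d ^ 2 * ξ s d ≤
      (∑ s ∈ Finset.range t, ∑ d, (P ^ (t - s)) k d * ξ s d + epsC lam u k) / M := by
  have geometric : ∑ s ∈ Finset.range t, ∑ p, ∑ j : Fin M with 0 < j.val,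
      |lam p * lam j| ^ (t - s) * aCoef lam u k p j ≤ epsC lam u k / M := by
    rw [epsC, mul_div_cancel_left₀ _ (Nat.cast_ne_zero.mpr k.pos.ne'), Finset.sum_comm]
    refine Finset.sum_le_sum fun p _ ↦ ?_
    rw [Finset.sum_comm]
    refine Finset.sum_le_sum fun j hj ↦ ?_
    rw [← Finset.sum_mul]
    exact mul_le_mul_of_nonneg_right (sum_pow_sub_le (abs_nonneg _)
      (h.abs_lam_mul_lam_lt_one p (Finset.mem_filter.mp hj).2) t) (aCoef_nonneg lam u k p j)
  have := Finset.sum_le_sum fun s (_ : s ∈ Finset.range t) ↦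
    h.sum_pow_apply_sq_mul_le (t - s) k (hξ s)
  rw [Finset.sum_add_distrib, ← Finset.sum_div] at this
  rw [add_div]
  linarith

end ConsensusSum

/-! ### Running consensus estimates -/

section MulVec

variable {n : Type*} [Fintype n] [DecidableEq n] {P : Matrix n n ℝ} {c : ℝ} {v : n → ℝ}

theorem le_mulVec_of_mem_rowStochastic (hP : P ∈ Matrix.rowStochastic ℝ n) (hv : ∀ d, c ≤ v d)
    (k : n) : c ≤ (P *ᵥ v) k := by
  rw [← one_mul c, ← Matrix.sum_row_of_mem_rowStochastic hP k, Finset.sum_mul]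
  exact Finset.sum_le_sum fun d _ ↦
    mul_le_mul_of_nonneg_left (hv d) (Matrix.nonneg_of_mem_rowStochastic hP)

theorem mulVec_le_of_mem_rowStochastic (hP : P ∈ Matrix.rowStochastic ℝ n) (hv : ∀ d, v d ≤ c)
    (k : n) : (P *ᵥ v) k ≤ c := by
  have := le_mulVec_of_mem_rowStochastic hP (v := -v) (fun d ↦ neg_le_neg (hv d)) k
  rwa [Matrix.mulVec_neg, Pi.neg_apply, neg_le_neg_iff] at this

end MulVec

section Estimates

variable {M N : ℕ} {P : Matrix (Fin M) (Fin M) ℝ} {a : ℕ → Fin M → Fin N}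

theorem ite_one_zero_mem_Icc (p : Prop) [Decidable p] :
    (if p then (1 : ℝ) else 0) ∈ Set.Icc (0 : ℝ) 1 := by
  split_ifs <;> simp

theorem nHat_nonneg (hP : P ∈ Matrix.rowStochastic ℝ (Fin M)) (a : ℕ → Fin M → Fin N)
    (i : Fin N) (t : ℕ) (k : Fin M) : 0 ≤ nHat P a i t k := by
  induction t generalizing k with
  | zero => exact le_rfl
  | succ t ih =>
    exact le_mulVec_of_mem_rowStochastic hP
      (fun d ↦ add_nonneg (ih d) (ite_one_zero_mem_Icc _).1) k

theorem nHat_le (hP : P ∈ Matrix.rowStochastic ℝ (Fin M)) (a : ℕ → Fin M → Fin N) (i : Fin N)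
    (t : ℕ) (k : Fin M) : nHat P a i t k ≤ t := by
  induction t generalizing k with
  | zero => simp [nHat]
  | succ t ih =>
    rw [Nat.cast_succ]
    exact mulVec_le_of_mem_rowStochastic hP
      (fun d ↦ add_le_add (ih d) (ite_one_zero_mem_Icc _).2) k

theorem one_le_nHat (hP : P ∈ Matrix.rowStochastic ℝ (Fin M)) {s : ℕ} {i : Fin N}
    (ha : ∀ k, a (s + 1) k = i) {t : ℕ} (hst : s < t) (k : Fin M) : 1 ≤ nHat P a i t k := by
  induction t, hst using Nat.le_induction generalizing k with
  | base =>
    refine le_mulVec_of_mem_rowStochastic hP (fun d ↦ ?_) k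
    simpa [ha] using nHat_nonneg hP a i s d
  | succ t _ ih =>
    exact le_mulVec_of_mem_rowStochastic hP
      (fun d ↦ le_add_of_le_of_nonneg (ih d) (ite_one_zero_mem_Icc _).1) k

theorem eq_sum_pow_of_consensus {x z : ℕ → Fin M → ℝ} (h0 : x 0 = 0)
    (hx : ∀ t, x (t + 1) = P *ᵥ (x t + z (t + 1))) (t : ℕ) (k : Fin M) :
    x t k = ∑ s ∈ Finset.range t, ∑ d, (P ^ (t - s)) k d * z (s + 1) d := by
  suffices x t = ∑ s ∈ Finset.range t, (P ^ (t - s)) *ᵥ z (s + 1) by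
    rw [this, Finset.sum_apply]
    rfl
  induction t with
  | zero => simp [h0]
  | succ t ih =>
    rw [hx, ih, Finset.sum_range_succ, Matrix.mulVec_add, Matrix.mulVec_sum,
      Nat.add_sub_cancel_left, pow_one]
    congr 1
    refine Finset.sum_congr rfl fun s hs ↦ ?_
    rw [Matrix.mulVec_mulVec, ← pow_succ', Nat.sub_add_comm (Finset.mem_range.mp hs).le]

theorem nHat_eq_sum (P : Matrix (Fin M) (Fin M) ℝ) (a : ℕ → Fin M → Fin N) (i : Fin N) (t : ℕ)
    (k : Fin M) : nHat P a i t k = ∑ s ∈ Finset.range t, ∑ d,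
      (P ^ (t - s)) k d * (if a (s + 1) d = i then 1 else 0) :=
  eq_sum_pow_of_consensus (z := fun t d ↦ if a t d = i then 1 else 0) rfl (fun _ ↦ rfl) t k

theorem sHat_eq_sum (P : Matrix (Fin M) (Fin M) ℝ) (a : ℕ → Fin M → Fin N)
    (y : ℕ → Fin M → Fin N → ℝ) (i : Fin N) (t : ℕ) (k : Fin M) :
    sHat P a y i t k = ∑ s ∈ Finset.range t, ∑ d,
      (P ^ (t - s)) k d * (if a (s + 1) d = i then y (s + 1) d i else 0) :=
  eq_sum_pow_of_consensus (z := fun t d ↦ if a t d = i then y t d i else 0) rfl (fun _ ↦ rfl) t k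

/-- The number of selections of arm `i` by all agents until time `t`. It is real-valued because it
is compared with the consensus estimates. -/
def selCount (a : ℕ → Fin M → Fin N) (i : Fin N) (t : ℕ) : ℝ :=
  ∑ s ∈ Finset.range t, ∑ d, if a (s + 1) d = i then 1 else 0

variable {lam : Fin M → ℝ} {u : Fin M → Fin M → ℝ}

theorem IsMixing.selCount_div_sub_epsN_le_nHat (h : IsMixing P lam u) (a : ℕ → Fin M → Fin N)
    (i : Fin N) (t : ℕ) (k : Fin M) : selCount a i t / M - epsN lam ≤ nHat P a i t k := by
  rw [nHat_eq_sum]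
  exact h.mean_sub_epsN_le (fun _ _ ↦ ite_one_zero_mem_Icc _) t k

theorem IsMixing.sum_sq_mul_le_nHat (h : IsMixing P lam u) (a : ℕ → Fin M → Fin N)
    (i : Fin N) (t : ℕ) (k : Fin M) :
    ∑ s ∈ Finset.range t, ∑ d, (P ^ (t - s)) k d ^ 2 * (if a (s + 1) d = i then 1 else 0) ≤
      (nHat P a i t k + epsC lam u k) / M := by
  rw [nHat_eq_sum]
  exact h.sum_sq_mul_le (fun _ _ ↦ ite_one_zero_mem_Icc _) t k

end Estimates

/-! ### The exponential supermartingale of a previsible selection -/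

theorem lintegral_mul_ite_le {Ω : Type*} [mΩ : MeasurableSpace Ω] {μ : Measure Ω}
    {𝓕 𝓖 : MeasurableSpace Ω} (h𝓕 : 𝓕 ≤ mΩ) (h𝓖 : 𝓖 ≤ mΩ) (hind : Indep 𝓕 𝓖 μ)
    {F g : Ω → ENNReal} (hF : Measurable[𝓕] F) (hg : Measurable[𝓖] g)
    {B : Set Ω} [DecidablePred (· ∈ B)] (hB : MeasurableSet[𝓕] B) (hg1 : ∫⁻ ω, g ω ∂μ ≤ 1) :
    ∫⁻ ω, F ω * (if ω ∈ B then g ω else 1) ∂μ ≤ ∫⁻ ω, F ω ∂μ := by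
  have measurable_on : Measurable[𝓕] (B.indicator F) := hF.indicator hB
  have measurable_off : Measurable[mΩ] (Bᶜ.indicator F) :=
    (hF.indicator hB.compl).mono h𝓕 le_rfl
  calc ∫⁻ ω, F ω * (if ω ∈ B then g ω else 1) ∂μ
      = ∫⁻ ω, (B.indicator F ω * g ω + Bᶜ.indicator F ω) ∂μ := by
        refine lintegral_congr fun ω ↦ ?_
        by_cases hω : ω ∈ B <;> simp [hω]
    _ = (∫⁻ ω, B.indicator F ω ∂μ) * (∫⁻ ω, g ω ∂μ) + ∫⁻ ω, Bᶜ.indicator F ω ∂μ := by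
        rw [lintegral_add_right _ measurable_off,
          lintegral_mul_eq_lintegral_mul_lintegral_of_independent_measurableSpace h𝓕 h𝓖 hind
            measurable_on hg]
    _ ≤ (∫⁻ ω, B.indicator F ω ∂μ) + ∫⁻ ω, Bᶜ.indicator F ω ∂μ := by
        gcongr
        exact mul_le_of_le_one_right' hg1
    _ = ∫⁻ ω, F ω ∂μ := by
        rw [← lintegral_add_right _ measurable_off]
        exact lintegral_congr fun ω ↦ Set.indicator_self_add_compl_apply B F ω

section Rewards

variable {M N : ℕ} {Ω : Type*}

/-- The σ-algebra generated by the reward vectors with (time, agent) index in `S`. Unlike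
`pastRewards`, it can also contain the rewards of some of the agents at the current time, which lets
the agents be conditioned on one after the other. -/
@[reducible] def rewardsOn (r : ℕ → Fin M → Fin N → Ω → ℝ) (S : Set (ℕ × Fin M)) :
    MeasurableSpace Ω :=
  ⨆ q ∈ S, MeasurableSpace.comap (fun ω (i : Fin N) ↦ r q.1 q.2 i ω) inferInstance

variable {r : ℕ → Fin M → Fin N → Ω → ℝ} {S T : Set (ℕ × Fin M)}

theorem measurable_rewardsOn {q : ℕ × Fin M} (hq : q ∈ S) (i : Fin N) :
    Measurable[rewardsOn r S] (r q.1 q.2 i) :=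
  (measurable_pi_apply i).comp (Measurable.of_comap_le
    (f := fun ω (i : Fin N) ↦ r q.1 q.2 i ω) (le_iSup₂_of_le q hq le_rfl))

theorem rewardsOn_mono (h : S ⊆ T) : rewardsOn r S ≤ rewardsOn r T :=
  biSup_mono h

theorem pastRewards_le_rewardsOn (t : ℕ) : pastRewards r t ≤ rewardsOn r {q | q.1 < t} :=
  iSup₂_le fun s hs ↦ iSup₂_le fun k i ↦
    (measurable_rewardsOn (q := (s, k)) (S := {q | q.1 < t}) hs.2 i).comap_le

variable [mΩ : MeasurableSpace Ω] {μ : Measure Ω} {p : Fin N → Measure ℝ}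

theorem IsRewardProcess.rewardsOn_le (hr : IsRewardProcess μ p r) (S : Set (ℕ × Fin M)) :
    rewardsOn r S ≤ mΩ :=
  iSup₂_le fun _ _ ↦ (measurable_pi_lambda _ fun _ ↦ hr.measurable _ _ _).comap_le

theorem IsRewardProcess.indep_rewardsOn (hr : IsRewardProcess μ p r) (h : Disjoint S T) :
    Indep (rewardsOn r S) (rewardsOn r T) μ :=
  indep_iSup_of_disjoint
    (fun _ ↦ (measurable_pi_lambda _ fun _ ↦ hr.measurable _ _ _).comap_le) hr.indep h

theorem IsRewardProcess.lintegral_mul_prod_ite_le (hr : IsRewardProcess μ p r) {t : ℕ} {i : Fin N}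
    {g : Fin M → ℝ → ENNReal} (hgm : ∀ d, Measurable (g d))
    (hg : ∀ d, ∫⁻ ω, g d (r t d i ω) ∂μ ≤ 1) {F : Ω → ENNReal} (hF : Measurable[rewardsOn r S] F)
    {B : Fin M → Set Ω} [∀ d, DecidablePred (· ∈ B d)]
    (hB : ∀ d, MeasurableSet[rewardsOn r S] (B d)) {A : Finset (Fin M)}
    (hA : ∀ d ∈ A, (t, d) ∉ S) :
    ∫⁻ ω, F ω * ∏ d ∈ A, (if ω ∈ B d then g d (r t d i ω) else 1) ∂μ ≤ ∫⁻ ω, F ω ∂μ := by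
  induction A using Finset.induction_on generalizing S F with
  | empty => simp
  | insert d A hd ih =>
    simp only [Finset.prod_insert hd, ← mul_assoc]
    have reward_measurable {S' : Set (ℕ × Fin M)} (h : (t, d) ∈ S') :
        Measurable[rewardsOn r S'] fun ω ↦ g d (r t d i ω) :=
      (hgm d).comp (measurable_rewardsOn (q := (t, d)) h i)
    have mono : rewardsOn r S ≤ rewardsOn r (insert (t, d) S) :=
      rewardsOn_mono (Set.subset_insert _ _)
    calc _ ≤ ∫⁻ ω, F ω * (if ω ∈ B d then g d (r t d i ω) else 1) ∂μ := by
          refine ih (S := insert (t, d) S) ?_ (fun e ↦ mono _ (hB e)) fun e he ↦ ?_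
          · exact (hF.mono mono le_rfl).mul (Measurable.ite (mono _ (hB d))
              (reward_measurable (Set.mem_insert _ _)) measurable_const)
          · have hne : e ≠ d := ne_of_mem_of_not_mem he hd
            simpa [hne] using hA e (Finset.mem_insert_of_mem he)
      _ ≤ ∫⁻ ω, F ω ∂μ :=
          lintegral_mul_ite_le (hr.rewardsOn_le S) (hr.rewardsOn_le {(t, d)})
            (hr.indep_rewardsOn
              (Set.disjoint_singleton_right.mpr (hA d (Finset.mem_insert_self ..))))
            hF (reward_measurable rfl) (hB d) (hg d)

theorem IsRewardProcess.lintegral_prod_selected_le_one [IsProbabilityMeasure μ]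
    (hr : IsRewardProcess μ p r) {arm : ℕ → Fin M → Ω → Fin N}
    (harm : ∀ t : ℕ, 1 ≤ t → ∀ k : Fin M, Measurable[pastRewards r t] (arm t k)) {i : Fin N}
    {g : ℕ → Fin M → ℝ → ENNReal} (hgm : ∀ s d, Measurable (g s d))
    (hg : ∀ s d, ∫⁻ ω, g s d (r (s + 1) d i ω) ∂μ ≤ 1) (n : ℕ) :
    ∫⁻ ω, ∏ s ∈ Finset.range n, ∏ d,
      (if arm (s + 1) d ω = i then g s d (r (s + 1) d i ω) else 1) ∂μ ≤ 1 := by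
  have selection_measurable {s n : ℕ} (hsn : s ≤ n) (d : Fin M) :
      MeasurableSet[rewardsOn r {q | q.1 < n + 1}] {ω | arm (s + 1) d ω = i} := by
    refine rewardsOn_mono ?_ _ (pastRewards_le_rewardsOn (s + 1) _
      (harm (s + 1) s.succ_pos d (MeasurableSet.singleton i)))
    exact fun q (hq : q.1 < s + 1) ↦ hq.trans_le (Nat.succ_le_succ hsn)
  induction n with
  | zero => simp
  | succ n ih =>
    simp only [Finset.prod_range_succ]
    refine le_trans (hr.lintegral_mul_prod_ite_le (t := n + 1) (S := {q | q.1 < n + 1})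
      (B := fun d ↦ {ω | arm (n + 1) d ω = i}) (hgm n) (hg n) ?_ (selection_measurable le_rfl)
      fun d _ ↦ by simp) ih
    refine Finset.measurable_prod _ fun s hs ↦ Finset.measurable_prod _ fun d _ ↦ ?_
    have hsn : s < n := Finset.mem_range.mp hs
    exact Measurable.ite (selection_measurable hsn.le d)
      ((hgm s d).comp (measurable_rewardsOn (q := (s + 1, d)) (Nat.succ_lt_succ hsn) i))
      measurable_const

theorem IsSubGaussian.lintegral_exp_le_one [IsProbabilityMeasure μ] {p : Measure ℝ} {σ : ℝ}
    (hp : IsSubGaussian p σ) {X : Ω → ℝ} (hX : HasLaw X p μ) (c : ℝ) :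
    ∫⁻ ω, ENNReal.ofReal (Real.exp (c * (X ω - ∫ x, x ∂p) - c ^ 2 * σ ^ 2 / 2)) ∂μ ≤ 1 := by
  have : IsProbabilityMeasure p := hX.isProbabilityMeasure_iff.mp ‹_›
  obtain ⟨exp_integrable, cgf_le⟩ := hp.2 c
  set m := ∫ x, x ∂p
  set b := m * c + σ ^ 2 * c ^ 2 / 2 with hb
  have exp_eq (x : ℝ) : Real.exp (c * (x - m) - c ^ 2 * σ ^ 2 / 2) =
      Real.exp (c * x) * Real.exp (-b) := by
    rw [← Real.exp_add, hb]
    ring_nf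
  simp only [exp_eq]
  calc ∫⁻ ω, ENNReal.ofReal (Real.exp (c * X ω) * Real.exp (-b)) ∂μ
      = ∫⁻ x, ENNReal.ofReal (Real.exp (c * x) * Real.exp (-b)) ∂p :=
        hX.lintegral_comp (f := fun x ↦ ENNReal.ofReal (Real.exp (c * x) * Real.exp (-b)))
          (by fun_prop)
    _ = ENNReal.ofReal (mgf id p c * Real.exp (-b)) := by
        rw [← ofReal_integral_eq_lintegral_ofReal (exp_integrable.mul_const _)
          (ae_of_all _ fun x ↦ by positivity), integral_mul_const]
        rfl
    _ ≤ 1 := by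
        rw [← exp_cgf (X := id) exp_integrable, ← Real.exp_add, ENNReal.ofReal_le_one,
          Real.exp_le_one_iff]
        linarith

theorem IsRewardProcess.lintegral_exp_sum_selected_le_one [IsProbabilityMeasure μ]
    (hr : IsRewardProcess μ p r) {σ : ℝ} {i : Fin N} (hp : IsSubGaussian (p i) σ)
    {arm : ℕ → Fin M → Ω → Fin N}
    (harm : ∀ t : ℕ, 1 ≤ t → ∀ k : Fin M, Measurable[pastRewards r t] (arm t k))
    (w : ℕ → Fin M → ℝ) (n : ℕ) :
    ∫⁻ ω, ENNReal.ofReal (Real.exp (∑ s ∈ Finset.range n, ∑ d, if arm (s + 1) d ω = i then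
      w s d * (r (s + 1) d i ω - ∫ x, x ∂(p i)) - w s d ^ 2 * σ ^ 2 / 2 else 0)) ∂μ ≤ 1 := by
  refine le_trans (le_of_eq (lintegral_congr fun ω ↦ ?_)) (hr.lintegral_prod_selected_le_one harm
    (i := i) (g := fun s d x ↦ ENNReal.ofReal
      (Real.exp (w s d * (x - ∫ x, x ∂(p i)) - w s d ^ 2 * σ ^ 2 / 2)))
    (fun s d ↦ by fun_prop) (fun s d ↦ hp.lintegral_exp_le_one (hr.law _ _ _) _) n)
  rw [Real.exp_sum, ENNReal.ofReal_prod_of_nonneg fun _ _ ↦ (Real.exp_pos _).le]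
  refine Finset.prod_congr rfl fun s _ ↦ ?_
  rw [Real.exp_sum, ENNReal.ofReal_prod_of_nonneg fun _ _ ↦ (Real.exp_pos _).le]
  refine Finset.prod_congr rfl fun d _ ↦ ?_
  split_ifs <;> simp

/-- The arms selected by the agents in the realization `ω`. -/
abbrev armsAt (arm : ℕ → Fin M → Ω → Fin N) (ω : Ω) : ℕ → Fin M → Fin N :=
  fun s d ↦ arm s d ω

/-- The rewards in the realization `ω`. -/
abbrev rewardsAt (r : ℕ → Fin M → Fin N → Ω → ℝ) (ω : Ω) : ℕ → Fin M → Fin N → ℝ :=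
  fun s d i ↦ r s d i ω

theorem IsMixing.lintegral_exp_noise_le_one [IsProbabilityMeasure μ]
    {P : Matrix (Fin M) (Fin M) ℝ} {lam : Fin M → ℝ} {u : Fin M → Fin M → ℝ}
    (h : IsMixing P lam u) (hr : IsRewardProcess μ p r) {σ : ℝ} {i : Fin N}
    (hp : IsSubGaussian (p i) σ) {arm : ℕ → Fin M → Ω → Fin N}
    (harm : ∀ t : ℕ, 1 ≤ t → ∀ k : Fin M, Measurable[pastRewards r t] (arm t k))
    (t : ℕ) {k : Fin M} {c : ℝ} (hc : epsC lam u k ≤ c) (θ : ℝ) :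
    ∫⁻ ω, ENNReal.ofReal (Real.exp (θ * (sHat P (armsAt arm ω) (rewardsAt r ω) i t k -
      (∫ x, x ∂(p i)) * nHat P (armsAt arm ω) i t k) -
      θ ^ 2 / 2 * (σ ^ 2 * ((nHat P (armsAt arm ω) i t k + c) / M)))) ∂μ ≤ 1 := by
  refine le_trans (lintegral_mono fun ω ↦ ENNReal.ofReal_le_ofReal (Real.exp_le_exp.mpr ?_))
    (hr.lintegral_exp_sum_selected_le_one hp harm (fun s d ↦ θ * (P ^ (t - s)) k d) t)
  set a := armsAt arm ω
  set m := ∫ x, x ∂(p i)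
  have sum_sq_le : ∑ s ∈ Finset.range t, ∑ d,
      (P ^ (t - s)) k d ^ 2 * (if a (s + 1) d = i then 1 else 0) ≤ (nHat P a i t k + c) / M :=
    (h.sum_sq_mul_le_nHat a i t k).trans (by gcongr)
  calc θ * (sHat P a (rewardsAt r ω) i t k - m * nHat P a i t k) -
        θ ^ 2 / 2 * (σ ^ 2 * ((nHat P a i t k + c) / M))
      ≤ θ * (sHat P a (rewardsAt r ω) i t k - m * nHat P a i t k) -
        θ ^ 2 / 2 * (σ ^ 2 * ∑ s ∈ Finset.range t, ∑ d,
          (P ^ (t - s)) k d ^ 2 * (if a (s + 1) d = i then 1 else 0)) := by gcongr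
    _ = _ := by
      rw [sHat_eq_sum, nHat_eq_sum]
      simp only [Finset.mul_sum, ← Finset.sum_sub_distrib]
      refine Finset.sum_congr rfl fun s _ ↦ Finset.sum_congr rfl fun d _ ↦ ?_
      change _ = if a (s + 1) d = i then _ else _
      split_ifs <;> ring

end Rewards


/-! ### Self-normalized deviations by peeling -/

section Peeling

theorem gFun_pos {η : ℝ} (hη : η ∈ Set.Ioo (0 : ℝ) 4) : 0 < gFun η := by
  rw [gFun]
  nlinarith [hη.1, hη.2]

theorem gFun_div_two_le {η z y : ℝ} (hz : 1 ≤ z) (hz4 : z ^ 4 = 1 + η) (hzy : z⁻¹ ≤ y)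
    (hyz : y ≤ z) : gFun η / 2 ≤ y - y ^ 2 / 2 := by
  have sub_one_le : z - 1 ≤ η / 4 := by
    have bernoulli := one_add_mul_le_pow (a := z - 1) (by linarith) 4
    rw [add_sub_cancel, hz4] at bernoulli
    push_cast at bernoulli
    linarith
  have one_sub_inv_le : 1 - z⁻¹ ≤ z - 1 := by
    have : 0 < z := by linarith
    rw [← sub_nonneg, show z - 1 - (1 - z⁻¹) = (z - 1) ^ 2 / z by field_simp]
    positivity
  have sq_le : (1 - y) ^ 2 ≤ (η / 4) ^ 2 := sq_le_sq' (by linarith) (by linarith)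
  rw [gFun]
  linarith

/-- The witness is the optimal tilt `δ / √w` at the geometric midpoint `w = A * √(1 + η)`. -/
theorem exists_tilt {η δ A : ℝ} (hη : 0 ≤ η) (hδ : 0 ≤ δ) (hA : 0 < A) :
    ∃ θ : ℝ, ∀ s w : ℝ, A ≤ w → w ≤ A * (1 + η) → δ * √w ≤ s →
      δ ^ 2 * gFun η / 2 ≤ θ * s - θ ^ 2 / 2 * w := by
  set z : ℝ := √√(1 + η)
  have one_le_z : 1 ≤ z := Real.one_le_sqrt.mpr (Real.one_le_sqrt.mpr (by linarith))
  have z_sq : z ^ 2 = √(1 + η) := Real.sq_sqrt (Real.sqrt_nonneg _)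
  have z_pow_four : z ^ 4 = 1 + η := by
    rw [show z ^ 4 = (z ^ 2) ^ 2 by ring, z_sq, Real.sq_sqrt (by linarith)]
  have z_pos : 0 < z := by linarith
  have : 0 < √A := Real.sqrt_pos.mpr hA
  refine ⟨δ / (√A * z), fun s w hAw hwA hs ↦ ?_⟩
  set y : ℝ := √w / (√A * z) with hy
  have inv_le_y : z⁻¹ ≤ y := by
    rw [hy, le_div_iff₀ (by positivity), mul_comm, mul_assoc, mul_inv_cancel₀ z_pos.ne', mul_one]
    exact Real.sqrt_le_sqrt hAw
  have y_le : y ≤ z := by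
    rw [hy, div_le_iff₀ (by positivity)]
    calc √w ≤ √(A * (1 + η)) := Real.sqrt_le_sqrt hwA
      _ = z * (√A * z) := by rw [Real.sqrt_mul hA.le, ← z_sq]; ring
  calc δ ^ 2 * gFun η / 2 = δ ^ 2 * (gFun η / 2) := by ring
    _ ≤ δ ^ 2 * (y - y ^ 2 / 2) := by
      gcongr
      exact gFun_div_two_le one_le_z z_pow_four inv_le_y y_le
    _ = δ / (√A * z) * (δ * √w) - (δ / (√A * z)) ^ 2 / 2 * √w ^ 2 := by rw [hy]; ring
    _ ≤ δ / (√A * z) * s - (δ / (√A * z)) ^ 2 / 2 * w := by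
      rw [Real.sq_sqrt (hA.le.trans hAw)]
      gcongr

variable {Ω : Type*} [MeasurableSpace Ω] {μ : Measure Ω} {S W : Ω → ℝ} {η δ A : ℝ}

theorem measure_slice_le (hS : Measurable S) (hW : Measurable W)
    (hexp : ∀ θ : ℝ, ∫⁻ ω, ENNReal.ofReal (Real.exp (θ * S ω - θ ^ 2 / 2 * W ω)) ∂μ ≤ 1)
    (hη : 0 ≤ η) (hδ : 0 ≤ δ) (hA : 0 < A) :
    μ {ω | δ * √(W ω) ≤ S ω ∧ A ≤ W ω ∧ W ω ≤ A * (1 + η)} ≤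
      ENNReal.ofReal (Real.exp (-(δ ^ 2 * gFun η / 2))) := by
  obtain ⟨θ, hθ⟩ := exists_tilt hη hδ hA
  set b : ℝ := δ ^ 2 * gFun η / 2
  calc μ {ω | δ * √(W ω) ≤ S ω ∧ A ≤ W ω ∧ W ω ≤ A * (1 + η)}
      ≤ μ {ω | ENNReal.ofReal (Real.exp b) ≤
          ENNReal.ofReal (Real.exp (θ * S ω - θ ^ 2 / 2 * W ω))} :=
        measure_mono fun ω ⟨hWS, hAW, hWA⟩ ↦
          ENNReal.ofReal_le_ofReal (Real.exp_le_exp.mpr (hθ _ _ hAW hWA hWS))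
    _ ≤ (∫⁻ ω, ENNReal.ofReal (Real.exp (θ * S ω - θ ^ 2 / 2 * W ω)) ∂μ) /
          ENNReal.ofReal (Real.exp b) :=
        meas_ge_le_lintegral_div (by fun_prop) (by simp [Real.exp_pos]) (by simp)
    _ ≤ 1 / ENNReal.ofReal (Real.exp b) := by
        gcongr
        exact hexp θ
    _ = ENNReal.ofReal (Real.exp (-b)) := by
        rw [one_div, Real.exp_neg, ENNReal.ofReal_inv_of_pos (Real.exp_pos _)]

theorem exists_slice (hη : 0 < η) (hA : 0 < A) {w τ : ℝ} (hAw : A ≤ w) (hwτ : w ≤ A * τ) :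
    ∃ l < ⌊Real.log τ / Real.log (1 + η)⌋₊ + 1,
      A * (1 + η) ^ l ≤ w ∧ w ≤ A * (1 + η) ^ l * (1 + η) := by
  obtain ⟨l, pow_le, lt_pow⟩ :=
    exists_nat_pow_near ((one_le_div hA).mpr hAw) (lt_add_of_pos_right 1 hη)
  have pow_le_τ : (1 + η) ^ l ≤ τ := pow_le.trans ((div_le_iff₀' hA).mpr hwτ)
  refine ⟨l, Nat.lt_succ_of_le (Nat.le_floor ?_), (le_div_iff₀' hA).mp pow_le, ?_⟩
  · rw [le_div_iff₀ (Real.log_pos (by linarith)), ← Real.log_pow]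
    exact Real.log_le_log (by positivity) pow_le_τ
  · rw [mul_assoc, ← pow_succ]
    exact ((div_lt_iff₀' hA).mp lt_pow).le

theorem measureReal_self_normalized_le (hS : Measurable S) (hW : Measurable W)
    (hexp : ∀ θ : ℝ, ∫⁻ ω, ENNReal.ofReal (Real.exp (θ * S ω - θ ^ 2 / 2 * W ω)) ∂μ ≤ 1)
    (hη : 0 < η) (hδ : 0 ≤ δ) (hA : 0 < A) {τ : ℝ} (hτ : 1 ≤ τ) (hAW : ∀ ω, A ≤ W ω)
    (hWτ : ∀ ω, W ω ≤ A * τ) :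
    μ.real {ω | δ * √(W ω) ≤ S ω} ≤
      (Real.log τ / Real.log (1 + η) + 1) * Real.exp (-(δ ^ 2 * gFun η / 2)) := by
  set D : ℕ := ⌊Real.log τ / Real.log (1 + η)⌋₊ + 1 with hD
  set E : ℝ := Real.exp (-(δ ^ 2 * gFun η / 2))
  have subset_slices : {ω | δ * √(W ω) ≤ S ω} ⊆ ⋃ l ∈ Finset.range D,
      {ω | δ * √(W ω) ≤ S ω ∧ A * (1 + η) ^ l ≤ W ω ∧ W ω ≤ A * (1 + η) ^ l * (1 + η)} := by
    intro ω hω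
    obtain ⟨l, hl, hWl⟩ := exists_slice hη hA (hAW ω) (hWτ ω)
    exact Set.mem_biUnion (Finset.mem_coe.mpr (Finset.mem_range.mpr hl)) ⟨hω, hWl⟩
  have measure_le : μ {ω | δ * √(W ω) ≤ S ω} ≤ ENNReal.ofReal (D * E) := by
    calc μ {ω | δ * √(W ω) ≤ S ω} ≤ ∑ l ∈ Finset.range D, μ {ω | δ * √(W ω) ≤ S ω ∧
          A * (1 + η) ^ l ≤ W ω ∧ W ω ≤ A * (1 + η) ^ l * (1 + η)} :=
          (measure_mono subset_slices).trans (measure_biUnion_finset_le _ _)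
      _ ≤ ∑ _l ∈ Finset.range D, ENNReal.ofReal E :=
          Finset.sum_le_sum fun _ _ ↦ measure_slice_le hS hW hexp hη.le hδ (by positivity)
      _ = ENNReal.ofReal (D * E) := by
          rw [Finset.sum_const, Finset.card_range, nsmul_eq_mul,
            ENNReal.ofReal_mul (Nat.cast_nonneg D), ENNReal.ofReal_natCast]
  calc μ.real {ω | δ * √(W ω) ≤ S ω} ≤ D * E :=
        ENNReal.toReal_le_of_le_ofReal (by positivity) measure_le
    _ ≤ (Real.log τ / Real.log (1 + η) + 1) * E := by
        rw [hD, Nat.cast_succ]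
        gcongr
        exact Nat.floor_le (div_nonneg (Real.log_nonneg hτ) (Real.log_pos (by linarith)).le)

end Peeling

/-! ### Deviations of the estimated means -/

/-- The estimate `ŝ_i^k(t) / n̂_i^k(t)` of the mean reward at arm `i` by agent `k`. -/
noncomputable def estMean {M N : ℕ} (P : Matrix (Fin M) (Fin M) ℝ) (a : ℕ → Fin M → Fin N)
    (y : ℕ → Fin M → Fin N → ℝ) (i : Fin N) (t : ℕ) (k : Fin M) : ℝ :=
  sHat P a y i t k / nHat P a i t k

/-- A bound on the probability that, at time `t`, the estimated mean of a given arm exceeds the true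
one by the exploration term: the number of slices of `1 ≤ n̂ ≤ t` times the bound for one slice. -/
noncomputable def deviationBound (γ η : ℝ) (t : ℕ) : ℝ :=
  (Real.log t / Real.log (1 + η) + 1) * (t : ℝ) ^ (-γ)

theorem mul_explore {M : ℕ} {σ γ η : ℝ} (f : ℝ → ℝ) (hσ : 0 ≤ σ) {t : ℕ} {n : ℝ} (hn : 0 < n)
    (hc : 0 ≤ 2 * γ * Real.log t / gFun η) :
    n * explore M σ γ η f t n =
      √(2 * γ * Real.log t / gFun η) * √(σ ^ 2 * ((n + f t) / M)) := by
  rw [explore, ← Real.sqrt_mul hc]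
  calc n * (σ * √(2 * γ / gFun η * ((n + f t) / (M * n)) * (Real.log t / n)))
      = √((n * σ) ^ 2) * √(2 * γ / gFun η * ((n + f t) / (M * n)) * (Real.log t / n)) := by
        rw [Real.sqrt_sq (by positivity), ← mul_assoc]
    _ = √(2 * γ * Real.log t / gFun η * (σ ^ 2 * ((n + f t) / M))) := by
        rw [← Real.sqrt_mul (sq_nonneg _)]
        congr 1
        field_simp

section Deviation

variable {M N : ℕ} {Ω : Type*} {arm : ℕ → Fin M → Ω → Fin N}
  {r : ℕ → Fin M → Fin N → Ω → ℝ} {P : Matrix (Fin M) (Fin M) ℝ} {σ γ η : ℝ} {f : ℝ → ℝ}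

theorem IsCoopUCB2.one_le_nHat (h : IsCoopUCB2 P σ γ η f r arm)
    (hP : P ∈ Matrix.rowStochastic ℝ (Fin M)) {t : ℕ} (ht : N ≤ t) (i : Fin N) (k : Fin M)
    (ω : Ω) : 1 ≤ nHat P (armsAt arm ω) i t k :=
  CoopUCB.one_le_nHat hP (fun d ↦ h.init i d ω) (i.isLt.trans_le ht) k

variable [MeasurableSpace Ω]

theorem measurable_sum_selected (harm : ∀ s d, Measurable (arm (s + 1) d)) (i : Fin N)
    (w : ℕ → Fin M → ℝ) {x : ℕ → Fin M → Ω → ℝ} (hx : ∀ s d, Measurable (x s d)) (t : ℕ) :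
    Measurable fun ω ↦ ∑ s ∈ Finset.range t, ∑ d,
      w s d * (if arm (s + 1) d ω = i then x s d ω else 0) :=
  Finset.measurable_fun_sum _ fun s _ ↦ Finset.measurable_fun_sum _ fun d _ ↦
    (Measurable.ite (harm s d (MeasurableSet.singleton i)) (hx s d) measurable_const).const_mul _

theorem measurable_nHat (harm : ∀ s d, Measurable (arm (s + 1) d)) (P : Matrix (Fin M) (Fin M) ℝ)
    (i : Fin N) (t : ℕ) (k : Fin M) : Measurable fun ω ↦ nHat P (armsAt arm ω) i t k := by
  simpa only [nHat_eq_sum] using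
    measurable_sum_selected harm i _ (x := fun _ _ _ ↦ 1) (fun _ _ ↦ measurable_const) t

theorem measurable_sHat (harm : ∀ s d, Measurable (arm (s + 1) d))
    (hr : ∀ t k i, Measurable (r t k i))
    (P : Matrix (Fin M) (Fin M) ℝ) (i : Fin N) (t : ℕ) (k : Fin M) :
    Measurable fun ω ↦ sHat P (armsAt arm ω) (rewardsAt r ω) i t k := by
  simpa only [sHat_eq_sum] using
    measurable_sum_selected harm i _ (x := fun s d ↦ r (s + 1) d i) (fun s d ↦ hr (s + 1) d i) t

theorem measurable_selCount (harm : ∀ s d, Measurable (arm (s + 1) d)) (i : Fin N) (t : ℕ) :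
    Measurable fun ω ↦ selCount (armsAt arm ω) i t := by
  simpa [selCount] using measurable_sum_selected harm i (fun _ _ ↦ 1) (x := fun _ _ _ ↦ 1)
    (fun _ _ ↦ measurable_const) t

variable {μ : Measure Ω} {p : Fin N → Measure ℝ} {lam : Fin M → ℝ} {u : Fin M → Fin M → ℝ}

theorem IsCoopUCB2.measurable (h : IsCoopUCB2 P σ γ η f r arm) (hr : IsRewardProcess μ p r)
    (s : ℕ) (d : Fin M) : Measurable (arm (s + 1) d) :=
  (h.previsible (s + 1) s.succ_pos d).mono
    ((pastRewards_le_rewardsOn _).trans (hr.rewardsOn_le _)) le_rfl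

theorem IsCoopUCB2.measureReal_sqrt_le_noise_le [IsProbabilityMeasure μ]
    (h : IsCoopUCB2 P σ γ η f r arm) (hP : IsMixing P lam u) (hr : IsRewardProcess μ p r)
    {i : Fin N} (hp : IsSubGaussian (p i) σ) (hσ : 0 < σ) (hη : 0 < η) {t : ℕ} (ht : N ≤ t)
    {k : Fin M} {b : ℝ} (hb : 0 ≤ b) (hk : epsC lam u k ≤ b) {c : ℝ} (hc : c ^ 2 = 1) {δ : ℝ}
    (hδ : 0 ≤ δ) :
    μ.real {ω | δ * √(σ ^ 2 * ((nHat P (armsAt arm ω) i t k + b) / M)) ≤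
      c * (sHat P (armsAt arm ω) (rewardsAt r ω) i t k -
        (∫ x, x ∂(p i)) * nHat P (armsAt arm ω) i t k)} ≤
      (Real.log t / Real.log (1 + η) + 1) * Real.exp (-(δ ^ 2 * gFun η / 2)) := by
  have hM : (0 : ℝ) < M := Nat.cast_pos.mpr k.pos
  have one_le_t : (1 : ℝ) ≤ t := Nat.one_le_cast.mpr (i.pos.trans_le ht)
  have nHat_measurable := measurable_nHat (h.measurable hr) P i t k
  have noise_measurable := ((measurable_sHat (h.measurable hr) hr.measurable P i t k).sub
    (nHat_measurable.const_mul (∫ x, x ∂(p i)))).const_mul c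
  refine measureReal_self_normalized_le noise_measurable (by fun_prop) (fun θ ↦ ?_) hη hδ
    (A := σ ^ 2 * ((1 + b) / M)) (by positivity) one_le_t (fun ω ↦ ?_) fun ω ↦ ?_
  · simpa only [Pi.sub_apply, ← mul_assoc, mul_pow, hc, mul_one] using
      hP.lintegral_exp_noise_le_one hr hp h.previsible t hk (θ * c)
  · gcongr
    exact h.one_le_nHat hP.stochastic ht i k ω
  · rw [mul_assoc, div_mul_eq_mul_div]
    gcongr
    have nHat_le_t := nHat_le hP.stochastic (armsAt arm ω) i t k
    nlinarith

theorem IsCoopUCB2.measureReal_explore_le_le [IsProbabilityMeasure μ]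
    (h : IsCoopUCB2 P σ γ η f r arm) (hP : IsMixing P lam u) (hr : IsRewardProcess μ p r)
    {i : Fin N} (hp : IsSubGaussian (p i) σ) (hσ : 0 < σ) (hγ : 0 ≤ γ)
    (hη : η ∈ Set.Ioo (0 : ℝ) 4) {t : ℕ} (ht : N ≤ t) (hf : 0 ≤ f t) {k : Fin M}
    (hk : epsC lam u k ≤ f t) {c : ℝ} (hc : c ^ 2 = 1) :
    μ.real {ω | explore M σ γ η f t (nHat P (armsAt arm ω) i t k) ≤
      c * (estMean P (armsAt arm ω) (rewardsAt r ω) i t k - ∫ x, x ∂(p i))} ≤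
      deviationBound γ η t := by
  have one_le_t : (1 : ℝ) ≤ t := Nat.one_le_cast.mpr (i.pos.trans_le ht)
  have gFun_pos := gFun_pos hη
  have ratio_nonneg : 0 ≤ 2 * γ * Real.log t / gFun η := by
    have := Real.log_nonneg one_le_t
    positivity
  refine (measureReal_mono fun ω hω ↦ ?_).trans
    ((h.measureReal_sqrt_le_noise_le hP hr hp hσ hη.1 ht hf hk hc
      (Real.sqrt_nonneg (2 * γ * Real.log t / gFun η))).trans_eq ?_)
  · have nHat_pos : 0 < nHat P (armsAt arm ω) i t k :=
      one_pos.trans_le (h.one_le_nHat hP.stochastic ht i k ω)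
    rw [Set.mem_ofPred_eq, ← mul_explore f hσ.le nHat_pos ratio_nonneg]
    refine (mul_le_mul_of_nonneg_left hω nHat_pos.le).trans_eq ?_
    rw [estMean]
    field_simp
  · rw [deviationBound, Real.rpow_def_of_pos (by linarith), Real.sq_sqrt ratio_nonneg]
    congr 2
    field_simp

end Deviation

/-! ### Sums over time -/

theorem sum_Ico_succ_le_of_antitoneOn {g H : ℝ → ℝ} {m : ℕ} (hg : AntitoneOn g (Set.Ici m))
    (hH : ∀ x, (m : ℝ) ≤ x → HasDerivAt H (-g x) x) (hH_nonneg : ∀ x, (m : ℝ) ≤ x → 0 ≤ H x)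
    (n : ℕ) : ∑ s ∈ Finset.Ico (m + 1) n, g s ≤ H m := by
  rcases le_or_gt n m with hnm | hmn
  · rw [Finset.Ico_eq_empty_of_le (by omega), Finset.sum_empty]
    exact hH_nonneg m le_rfl
  obtain ⟨b, rfl⟩ : ∃ b, n = b + 1 := ⟨n - 1, by omega⟩
  have hmb : m ≤ b := Nat.lt_succ_iff.mp hmn
  have hmb_real : (m : ℝ) ≤ b := Nat.cast_le.mpr hmb
  have antitone_Icc : AntitoneOn g (Set.Icc m b) := hg.mono Set.Icc_subset_Ici_self
  have integral_eq : ∫ x in (m : ℝ)..b, g x = H m - H b := by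
    have antitone_uIcc : AntitoneOn g (Set.uIcc m b) := Set.uIcc_of_le hmb_real ▸ antitone_Icc
    have := intervalIntegral.integral_eq_sub_of_hasDerivAt (a := (m : ℝ)) (b := b)
      (fun x hx ↦ hH x (by rw [Set.uIcc_of_le hmb_real] at hx; exact hx.1))
      antitone_uIcc.intervalIntegrable.neg
    rw [intervalIntegral.integral_neg] at this
    linarith
  calc ∑ s ∈ Finset.Ico (m + 1) (b + 1), g s = ∑ s ∈ Finset.Ico m b, g ((s + 1 : ℕ) : ℝ) :=
        (Finset.sum_Ico_add' (fun s : ℕ ↦ g s) m b 1).symm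
    _ ≤ ∫ x in (m : ℝ)..b, g x := antitone_Icc.sum_le_integral_Ico hmb
    _ ≤ H m := by linarith [hH_nonneg b hmb_real]

theorem sum_Ico_one_le_add_sum_Ico {g : ℕ → ℝ} (hg : ∀ s, 0 ≤ g s) (m n : ℕ) :
    ∑ s ∈ Finset.Ico 1 n, g s ≤ ∑ s ∈ Finset.Ico 1 m, g s + ∑ s ∈ Finset.Ico m n, g s := by
  rw [← Finset.sum_union (Finset.Ico_disjoint_Ico_consecutive 1 m n)]
  refine Finset.sum_le_sum_of_subset_of_nonneg (fun s hs ↦ ?_) fun s _ _ ↦ hg s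
  simp only [Finset.mem_union, Finset.mem_Ico] at hs ⊢
  omega

section PowerSums

variable {γ : ℝ}

theorem sum_rpow_neg_le (hγ : 1 < γ) (n : ℕ) :
    ∑ s ∈ Finset.Ico 1 n, (s : ℝ) ^ (-γ) ≤ γ / (γ - 1) := by
  have : 0 < γ - 1 := sub_pos.mpr hγ
  have tail_le := sum_Ico_succ_le_of_antitoneOn (g := fun x ↦ x ^ (-γ))
    (H := fun x ↦ x ^ (1 - γ) / (γ - 1)) (m := 1)
    (fun x hx y _ hxy ↦ Real.rpow_le_rpow_of_nonpos
      (one_pos.trans_le (by simpa using hx)) hxy (by linarith))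
    (fun x hx ↦ ?_) (fun x hx ↦ ?_) n
  · refine (sum_Ico_one_le_add_sum_Ico (fun s ↦ by positivity) 2 n).trans
      ((add_le_add_right tail_le _).trans_eq ?_)
    have head_eq : ∑ s ∈ Finset.Ico (1 : ℕ) 2, (s : ℝ) ^ (-γ) = 1 := by simp
    rw [head_eq, Nat.cast_one, Real.one_rpow]
    field_simp
    ring
  · have hx0 : 0 < x := one_pos.trans_le (by simpa using hx)
    refine ((Real.hasDerivAt_rpow_const (Or.inl hx0.ne')).div_const _).congr_deriv ?_
    rw [show 1 - γ - 1 = -γ by ring]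
    field_simp
    ring
  · have : 0 < x := one_pos.trans_le (by simpa using hx)
    positivity

theorem log_mul_rpow_neg_le_half {x : ℝ} (hγ : 1 ≤ γ) (hx : 1 ≤ x) :
    Real.log x * x ^ (-γ) ≤ 1 / 2 := by
  have hx0 : 0 < x := one_pos.trans_le hx
  have rpow_le_inv : x ^ (-γ) ≤ x⁻¹ := by
    rw [← Real.rpow_neg_one]
    exact Real.rpow_le_rpow_of_exponent_le hx (neg_le_neg hγ)
  have log_le_half : Real.log x ≤ x / 2 := by
    have := Real.log_le_sub_one_of_pos (half_pos hx0)
    rw [Real.log_div hx0.ne' two_ne_zero] at this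
    linarith [Real.log_two_lt_d9]
  calc Real.log x * x ^ (-γ) ≤ x / 2 * x⁻¹ := by gcongr
    _ = 1 / 2 := by field_simp

theorem antitoneOn_log_mul_rpow_neg (hγ : 1 ≤ γ) :
    AntitoneOn (fun x : ℝ ↦ Real.log x * x ^ (-γ)) (Set.Ici 3) := by
  have exp_le_three : Real.exp γ⁻¹ ≤ 3 := by
    have := Real.exp_le_exp.mpr (inv_le_one_of_one_le₀ hγ)
    linarith [Real.exp_one_lt_d9]
  refine ((Real.log_div_self_rpow_antitoneOn (one_pos.trans_le hγ)).mono
    fun x hx ↦ exp_le_three.trans hx).congr fun x hx ↦ ?_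
  have hx0 : (0 : ℝ) ≤ x := le_trans (by norm_num) hx
  simp only [Real.rpow_neg hx0, div_eq_mul_inv]

/-- The primitive of `x ↦ -log x * x ^ (-γ)` that vanishes at infinity. -/
noncomputable def logPowerTail (γ x : ℝ) : ℝ :=
  (Real.log x / (γ - 1) + 1 / (γ - 1) ^ 2) * x ^ (1 - γ)

theorem hasDerivAt_logPowerTail (hγ : γ ≠ 1) {x : ℝ} (hx : 0 < x) :
    HasDerivAt (logPowerTail γ) (-(Real.log x * x ^ (-γ))) x := by
  have hγ1 : γ - 1 ≠ 0 := sub_ne_zero.mpr hγ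
  refine ((((Real.hasDerivAt_log hx.ne').div_const (γ - 1)).add_const (1 / (γ - 1) ^ 2)).mul
    (Real.hasDerivAt_rpow_const (p := 1 - γ) (Or.inl hx.ne'))).congr_deriv ?_
  have rpow_eq : x ^ (1 - γ) = x * x ^ (-γ) := by
    rw [sub_eq_add_neg, Real.rpow_add hx, Real.rpow_one]
  rw [show 1 - γ - 1 = -γ by ring, rpow_eq]
  field_simp
  ring

theorem antitoneOn_logPowerTail (hγ : γ ≠ 1) : AntitoneOn (logPowerTail γ) (Set.Ici 1) := by
  have hderiv : ∀ x ∈ Set.Ici (1 : ℝ), HasDerivAt (logPowerTail γ) (-(Real.log x * x ^ (-γ))) x :=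
    fun x hx ↦ hasDerivAt_logPowerTail hγ (one_pos.trans_le hx)
  refine antitoneOn_of_hasDerivWithinAt_nonpos (convex_Ici 1)
    (fun x hx ↦ (hderiv x hx).continuousAt.continuousWithinAt)
    (fun x hx ↦ (hderiv x (interior_subset hx)).hasDerivWithinAt) fun x hx ↦ ?_
  have hx1 : 1 ≤ x := interior_subset hx
  have := Real.log_nonneg hx1
  exact neg_nonpos.mpr (by positivity)

theorem sum_log_mul_rpow_neg_le (hγ : 1 < γ) (n : ℕ) :
    ∑ s ∈ Finset.Ico 1 n, Real.log s * (s : ℝ) ^ (-γ) ≤ 1 / (γ - 1) ^ 2 + 1 := by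
  have : 0 < γ - 1 := sub_pos.mpr hγ
  have tail_le : ∑ s ∈ Finset.Ico 4 n, Real.log s * (s : ℝ) ^ (-γ) ≤ logPowerTail γ 3 := by
    refine sum_Ico_succ_le_of_antitoneOn (g := fun x ↦ Real.log x * x ^ (-γ)) (m := 3)
      (by exact_mod_cast antitoneOn_log_mul_rpow_neg hγ.le)
      (fun x hx ↦ hasDerivAt_logPowerTail hγ.ne' (lt_of_lt_of_le (by norm_num) hx))
      (fun x hx ↦ ?_) n
    have hx1 : 1 ≤ x := le_trans (by norm_num) hx
    have := Real.log_nonneg hx1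
    unfold logPowerTail
    positivity
  have head_le : ∑ s ∈ Finset.Ico (1 : ℕ) 4, Real.log s * (s : ℝ) ^ (-γ) ≤ 1 := by
    have two_le := log_mul_rpow_neg_le_half hγ.le (show (1 : ℝ) ≤ 2 by norm_num)
    have three_le := log_mul_rpow_neg_le_half hγ.le (show (1 : ℝ) ≤ 3 by norm_num)
    calc ∑ s ∈ Finset.Ico (1 : ℕ) 4, Real.log s * (s : ℝ) ^ (-γ)
        = Real.log 2 * 2 ^ (-γ) + Real.log 3 * 3 ^ (-γ) := by simp [Finset.sum_Ico_succ_top]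
      _ ≤ 1 := by linarith
  calc ∑ s ∈ Finset.Ico 1 n, Real.log s * (s : ℝ) ^ (-γ)
      ≤ ∑ s ∈ Finset.Ico (1 : ℕ) 4, Real.log s * (s : ℝ) ^ (-γ) +
          ∑ s ∈ Finset.Ico 4 n, Real.log s * (s : ℝ) ^ (-γ) :=
        sum_Ico_one_le_add_sum_Ico
          (fun s ↦ mul_nonneg (Real.log_natCast_nonneg s) (by positivity)) 4 n
    _ ≤ 1 + logPowerTail γ 1 := add_le_add head_le (tail_le.trans
        (antitoneOn_logPowerTail hγ.ne' Set.self_mem_Ici (by norm_num) (by norm_num)))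
    _ = 1 / (γ - 1) ^ 2 + 1 := by simp [logPowerTail, add_comm]

end PowerSums

theorem deviationBound_nonneg {η : ℝ} (hη : 0 ≤ η) (γ : ℝ) (s : ℕ) :
    0 ≤ deviationBound γ η s := by
  have := Real.log_natCast_nonneg s
  have := Real.log_nonneg (le_add_of_nonneg_right hη)
  unfold deviationBound
  positivity

theorem sum_deviationBound_le {γ η : ℝ} (hγ : 1 < γ) (hη : 0 < η) (n : ℕ) :
    ∑ s ∈ Finset.Ico 1 n, deviationBound γ η s ≤
      (1 / (γ - 1) ^ 2 + γ * Real.log (1 + η) / (γ - 1) + 1) / Real.log (1 + η) := by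
  have log_pos : 0 < Real.log (1 + η) := Real.log_pos (by linarith)
  have hγ1 : γ - 1 ≠ 0 := (sub_pos.mpr hγ).ne'
  calc ∑ s ∈ Finset.Ico 1 n, deviationBound γ η s
      = (∑ s ∈ Finset.Ico 1 n, Real.log s * (s : ℝ) ^ (-γ)) / Real.log (1 + η) +
          ∑ s ∈ Finset.Ico 1 n, (s : ℝ) ^ (-γ) := by
        simp only [deviationBound, add_mul, one_mul, Finset.sum_add_distrib, Finset.sum_div,
          div_mul_eq_mul_div]
    _ ≤ (1 / (γ - 1) ^ 2 + 1) / Real.log (1 + η) + γ / (γ - 1) := by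
        gcongr
        exacts [sum_log_mul_rpow_neg_le hγ n, sum_rpow_neg_le hγ n]
    _ = _ := by
        field_simp
        ring

section ReachTime

variable {f : ℝ → ℝ} {ε : ℝ}

theorem one_le_reachTime (hreach : ∃ t, 1 ≤ t ∧ ε ≤ f t) : 1 ≤ reachTime f ε :=
  le_csInf hreach fun _ ht ↦ ht.1

theorem le_reachTime (hf : MonotoneOn f (Set.Ici 1)) (hreach : ∃ t, 1 ≤ t ∧ ε ≤ f t) {s : ℝ}
    (hs : 1 ≤ s) (hlt : f s < ε) : s ≤ reachTime f ε :=
  le_csInf hreach fun _ ht ↦ le_of_not_ge fun hts ↦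
    (hlt.trans_le ht.2).not_ge (hf ht.1 hs hts)

theorem card_filter_lt_le_reachTime (hf : MonotoneOn f (Set.Ici 1))
    (hreach : ∃ t, 1 ≤ t ∧ ε ≤ f t) (n : ℕ) :
    (((Finset.Ico 2 n).filter fun s : ℕ ↦ f s < ε).card : ℝ) ≤ reachTime f ε - 1 := by
  have one_le := one_le_reachTime hreach
  have subset_Icc : ((Finset.Ico 2 n).filter fun s : ℕ ↦ f s < ε) ⊆
      Finset.Icc 2 ⌊reachTime f ε⌋₊ := fun s hs ↦ by
    obtain ⟨hs2, hlt⟩ := Finset.mem_filter.mp hs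
    have two_le := (Finset.mem_Ico.mp hs2).1
    exact Finset.mem_Icc.mpr
      ⟨two_le, Nat.le_floor (le_reachTime hf hreach (Nat.one_le_cast.mpr (by omega)) hlt)⟩
  have one_le_floor : 1 ≤ ⌊reachTime f ε⌋₊ := Nat.le_floor (by simpa using one_le)
  have card_le := Finset.card_le_card subset_Icc
  rw [Nat.card_Icc] at card_le
  calc (((Finset.Ico 2 n).filter fun s : ℕ ↦ f s < ε).card : ℝ)
      ≤ ((⌊reachTime f ε⌋₊ - 1 : ℕ) : ℝ) := Nat.cast_le.mpr (by omega)
    _ ≤ reachTime f ε - 1 := by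
        rw [Nat.cast_sub one_le_floor, Nat.cast_one]
        exact sub_le_sub_right (Nat.floor_le (by linarith)) 1

-- Both the trivial bound `b s ≤ 1` and the deviation bound cover `s = 1`, as
-- `2 * deviationBound γ η 1 = 2`; hence only `reachTime f ε - 1` steps are lost.
theorem sum_le_reachTime_add_sum_deviationBound {γ η : ℝ} (hη : 0 ≤ η)
    (hf : MonotoneOn f (Set.Ici 1)) (hreach : ∃ t, 1 ≤ t ∧ ε ≤ f t) {b : ℕ → ℝ} {m : ℕ}
    (hm : 1 ≤ m) (n : ℕ) (hb_one : ∀ s, b s ≤ 1)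
    (hb : ∀ s ∈ Finset.Ico m n, ε ≤ f s → b s ≤ 2 * deviationBound γ η s) :
    ∑ s ∈ Finset.Ico m n, b s ≤
      reachTime f ε - 1 + 2 * ∑ s ∈ Finset.Ico 1 n, deviationBound γ η s := by
  have bound_nonneg : ∀ s, 0 ≤ 2 * deviationBound γ η s := fun s ↦
    mul_nonneg zero_le_two (deviationBound_nonneg hη γ s)
  have b_le : ∀ s ∈ Finset.Ico m n,
      b s ≤ (if 2 ≤ s ∧ f s < ε then 1 else 0) + 2 * deviationBound γ η s := fun s hs ↦ by
    by_cases hlt : f s < ε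
    · rcases le_or_gt 2 s with two_le | lt_two
      · rw [if_pos ⟨two_le, hlt⟩]
        linarith [hb_one s, bound_nonneg s]
      · obtain rfl : s = 1 := by have := (Finset.mem_Ico.mp hs).1; omega
        have bound_one : deviationBound γ η 1 = 1 := by simp [deviationBound]
        rw [if_neg fun h ↦ lt_two.not_ge h.1, bound_one]
        linarith [hb_one 1]
    · rw [if_neg fun h ↦ hlt h.2, zero_add]
      exact hb s hs (not_lt.mp hlt)
  have card_le : ∑ s ∈ Finset.Ico m n, (if 2 ≤ s ∧ f s < ε then (1 : ℝ) else 0) ≤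
      reachTime f ε - 1 := by
    rw [Finset.sum_boole]
    refine le_trans (Nat.cast_le.mpr (Finset.card_le_card fun s hs ↦ ?_))
      (card_filter_lt_le_reachTime hf hreach n)
    simp only [Finset.mem_filter, Finset.mem_Ico] at hs ⊢
    exact ⟨⟨hs.2.1, hs.1.2⟩, hs.2.2⟩
  rw [Finset.mul_sum]
  refine (Finset.sum_le_sum b_le).trans ?_
  rw [Finset.sum_add_distrib]
  exact add_le_add card_le (Finset.sum_le_sum_of_subset_of_nonneg
    (Finset.Ico_subset_Ico_left hm) fun s _ _ ↦ bound_nonneg s)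

end ReachTime

/-! ### Selections of a suboptimal arm -/

theorem mul_add_le_sq_of_half_add_sqrt_le {b c n : ℝ} (hb : 0 ≤ b) (hc : 0 ≤ c)
    (h : b / 2 + √(b ^ 2 / 4 + b * c) ≤ n) : b * (n + c) ≤ n ^ 2 := by
  have sqrt_sq_le := mul_self_le_mul_self (Real.sqrt_nonneg _) (le_sub_iff_add_le'.mpr h)
  rw [Real.mul_self_sqrt (by positivity)] at sqrt_sq_le
  linarith

/-- The number of selections of an arm with gap `Δ`, up to the consensus error, after which no
exploration term for this arm exceeds `Δ / 2` before time `T`. -/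
noncomputable def selThreshold (M : ℕ) (σ γ η : ℝ) (f : ℝ → ℝ) (T : ℕ) (Δ : ℝ) : ℝ :=
  4 * σ ^ 2 * γ * Real.log T / (Δ ^ 2 * gFun η) *
    (1 + √(1 + Δ ^ 2 * M * gFun η / (2 * γ * σ ^ 2) * (f T / Real.log T)))

/-- The coefficient `b` for which the exploration term `C` at `n` satisfies
`(2 C)² = Δ² b (n + f(t)) / n²`. -/
noncomputable def exploreCoef (M : ℕ) (σ γ η : ℝ) (t : ℕ) (Δ : ℝ) : ℝ :=
  8 * σ ^ 2 * γ * Real.log t / (gFun η * M * Δ ^ 2)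

section Explore

variable {M : ℕ} {σ γ η : ℝ} {f : ℝ → ℝ} {Δ n : ℝ}

theorem exploreCoef_nonneg (hγ : 0 ≤ γ) (hG : 0 ≤ gFun η) (t : ℕ) :
    0 ≤ exploreCoef M σ γ η t Δ := by
  have := Real.log_natCast_nonneg t
  unfold exploreCoef
  positivity

theorem selThreshold_nonneg (hγ : 0 ≤ γ) (hG : 0 ≤ gFun η) (T : ℕ) :
    0 ≤ selThreshold M σ γ η f T Δ := by
  have := Real.log_natCast_nonneg T
  unfold selThreshold
  positivity

theorem selThreshold_div_eq (hM : 0 < M) (hσ : 0 < σ) (hγ : 0 < γ) (hG : 0 < gFun η) (hΔ : 0 < Δ)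
    {T : ℕ} (hT : 1 < T) :
    selThreshold M σ γ η f T Δ / M = exploreCoef M σ γ η T Δ / 2 +
      √(exploreCoef M σ γ η T Δ ^ 2 / 4 + exploreCoef M σ γ η T Δ * f T) := by
  have : (0 : ℝ) < M := Nat.cast_pos.mpr hM
  have log_pos : 0 < Real.log T := Real.log_pos (Nat.one_lt_cast.mpr hT)
  have radicand_eq : exploreCoef M σ γ η T Δ ^ 2 / 4 + exploreCoef M σ γ η T Δ * f T =
      (exploreCoef M σ γ η T Δ / 2) ^ 2 *
        (1 + Δ ^ 2 * M * gFun η / (2 * γ * σ ^ 2) * (f T / Real.log T)) := by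
    rw [exploreCoef]
    field_simp
    ring
  have coef_nonneg := exploreCoef_nonneg (M := M) (σ := σ) (Δ := Δ) hγ.le hG.le T
  rw [radicand_eq, Real.sqrt_mul (sq_nonneg _), Real.sqrt_sq (by positivity), selThreshold,
    exploreCoef]
  field_simp
  ring

theorem explore_le_explore (hσ : 0 ≤ σ) (hγ : 0 ≤ γ) (hG : 0 ≤ gFun η) (hn : 0 ≤ n) {s T : ℕ}
    (hs : 1 ≤ s) (hsT : s ≤ T) (hfT : 0 ≤ f T) (hf : f s ≤ f T) :
    explore M σ γ η f s n ≤ explore M σ γ η f T n := by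
  have : (0 : ℝ) < s := Nat.cast_pos.mpr hs
  have := Real.log_natCast_nonneg s
  unfold explore
  gcongr

theorem two_mul_explore_sq (hM : 0 < M) (hγ : 0 ≤ γ) (hG : 0 < gFun η) (hΔ : 0 < Δ) (hn : 0 < n)
    {t : ℕ} (hf : 0 ≤ f t) :
    (2 * explore M σ γ η f t n) ^ 2 =
      Δ ^ 2 * (exploreCoef M σ γ η t Δ * (n + f t) / n ^ 2) := by
  have : (0 : ℝ) < M := Nat.cast_pos.mpr hM
  have := Real.log_natCast_nonneg t
  rw [explore, mul_pow, mul_pow, Real.sq_sqrt (by positivity), exploreCoef]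
  field_simp
  ring

theorem two_mul_explore_le (hM : 0 < M) (hσ : 0 < σ) (hγ : 0 < γ) (hG : 0 < gFun η)
    {s T : ℕ} (hs : 1 ≤ s) (hsT : s < T) (hfT : 0 ≤ f T) (hf : f s ≤ f T) (hΔ : 0 < Δ)
    (hn_pos : 0 < n) (hn : selThreshold M σ γ η f T Δ / M ≤ n) :
    2 * explore M σ γ η f s n ≤ Δ := by
  refine (mul_le_mul_of_nonneg_left
    (explore_le_explore hσ.le hγ.le hG.le hn_pos.le hs hsT.le hfT hf) zero_le_two).trans ?_
  refine le_of_sq_le_sq ?_ hΔ.le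
  rw [selThreshold_div_eq hM hσ hγ hG hΔ (hs.trans_lt hsT)] at hn
  have coef_mul_le := mul_add_le_sq_of_half_add_sqrt_le (exploreCoef_nonneg hγ.le hG.le T) hfT hn
  rw [two_mul_explore_sq hM hγ.le hG hΔ hn_pos hfT]
  exact mul_le_of_le_one_right (sq_nonneg Δ) (div_le_one_of_le₀ coef_mul_le (sq_nonneg n))

end Explore

section Selection

variable {M N : ℕ} {Ω : Type*} {P : Matrix (Fin M) (Fin M) ℝ} {lam : Fin M → ℝ}
  {u : Fin M → Fin M → ℝ} {σ γ η : ℝ} {f : ℝ → ℝ} {r : ℕ → Fin M → Fin N → Ω → ℝ}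
  {arm : ℕ → Fin M → Ω → Fin N} {m : Fin N → ℝ} {i j : Fin N} {s T : ℕ} {k : Fin M}

theorem IsMixing.le_nHat_of_lt_selCount (hP : IsMixing P lam u) {a : ℕ → Fin M → Fin N} {A : ℝ}
    (h : A + M * epsN lam < selCount a i s) (k : Fin M) : A / M ≤ nHat P a i s k := by
  have hM : (0 : ℝ) < M := Nat.cast_pos.mpr k.pos
  refine le_trans ?_ (hP.selCount_div_sub_epsN_le_nHat a i s k)
  rw [le_sub_iff_add_le, div_add' _ _ _ hM.ne', mul_comm (epsN lam)]
  gcongr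

-- Were both estimates within their exploration terms, then
-- `Q_i < m i + 2 C_i ≤ m i + gap m i = m j < Q_j`, and arm `i` would not maximize `Q`.
theorem IsCoopUCB2.explore_le_of_selected (h : IsCoopUCB2 P σ γ η f r arm) (hP : IsMixing P lam u)
    (hσ : 0 < σ) (hγ : 0 < γ) (hη : η ∈ Set.Ioo (0 : ℝ) 4) (hf_nonneg : ∀ t, 1 ≤ t → 0 ≤ f t)
    (hf : MonotoneOn f (Set.Ici 1)) (hj : m j = ⨆ l, m l) (hi : 0 < gap m i) (hs : N ≤ s)
    (hsT : s < T) {ω : Ω} (hsel : arm (s + 1) k ω = i)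
    (hcount : selThreshold M σ γ η f T (gap m i) + M * epsN lam <
      selCount (armsAt arm ω) i s) :
    explore M σ γ η f s (nHat P (armsAt arm ω) i s k) ≤
        estMean P (armsAt arm ω) (rewardsAt r ω) i s k - m i ∨
      explore M σ γ η f s (nHat P (armsAt arm ω) j s k) ≤
        m j - estMean P (armsAt arm ω) (rewardsAt r ω) j s k := by
  by_contra! hcon
  obtain ⟨est_i_lt, est_j_gt⟩ := hcon
  have one_le_s : 1 ≤ s := i.pos.trans_le hs
  have hs_real : (1 : ℝ) ≤ s := Nat.one_le_cast.mpr one_le_s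
  have hsT_real : (s : ℝ) ≤ T := Nat.cast_le.mpr hsT.le
  have hT_real : (1 : ℝ) ≤ T := hs_real.trans hsT_real
  have explore_le := two_mul_explore_le k.pos hσ hγ (gFun_pos hη) one_le_s hsT
    (hf_nonneg T hT_real) (hf hs_real hT_real hsT_real) hi
    (one_pos.trans_le (h.one_le_nHat hP.stochastic hs i k ω)) (hP.le_nHat_of_lt_selCount hcount k)
  have gap_eq : gap m i = m j - m i := by rw [gap, hj]
  have index_le : estMean P (armsAt arm ω) (rewardsAt r ω) j s k +
      explore M σ γ η f s (nHat P (armsAt arm ω) j s k) ≤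
      estMean P (armsAt arm ω) (rewardsAt r ω) i s k +
      explore M σ γ η f s (nHat P (armsAt arm ω) i s k) := hsel ▸ h.select s hs k ω j
  linarith

variable [MeasurableSpace Ω] {μ : Measure Ω} [IsProbabilityMeasure μ] {p : Fin N → Measure ℝ}

theorem IsCoopUCB2.measureReal_selected_le (h : IsCoopUCB2 P σ γ η f r arm)
    (hP : IsMixing P lam u) (hr : IsRewardProcess μ p r) (hp : ∀ i, IsSubGaussian (p i) σ)
    (hm : ∀ i, m i = ∫ x, x ∂(p i)) (hσ : 0 < σ) (hγ : 0 < γ) (hη : η ∈ Set.Ioo (0 : ℝ) 4)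
    (hf_nonneg : ∀ t, 1 ≤ t → 0 ≤ f t) (hf : MonotoneOn f (Set.Ici 1)) (hi : 0 < gap m i)
    (hs : N ≤ s) (hsT : s < T) (hk : epsC lam u k ≤ f s) :
    μ.real {ω | arm (s + 1) k ω = i ∧ selThreshold M σ γ η f T (gap m i) + M * epsN lam <
      selCount (armsAt arm ω) i s} ≤ 2 * deviationBound γ η s := by
  have : Nonempty (Fin N) := ⟨i⟩
  obtain ⟨j, hj⟩ := exists_eq_ciSup_of_finite (f := m)
  have hfs : 0 ≤ f s := hf_nonneg s (Nat.one_le_cast.mpr (i.pos.trans_le hs))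
  have over_i := h.measureReal_explore_le_le hP hr (hp i) hσ hγ.le hη hs hfs hk (one_pow 2)
  have under_j := h.measureReal_explore_le_le hP hr (hp j) hσ hγ.le hη hs hfs hk neg_one_sq
  simp only [one_mul, neg_one_mul, neg_sub, ← hm] at over_i under_j
  rw [two_mul]
  exact (measureReal_mono fun ω hω ↦ h.explore_le_of_selected hP hσ hγ hη hf_nonneg hf hj hi hs hsT
    hω.1 hω.2).trans ((measureReal_union_le _ _).trans (add_le_add over_i under_j))

end Selection

/-! ### Expected number of selections -/

theorem sum_range_le_add_sum_above {x : ℕ → ℝ} {A B : ℝ} (hA : 0 ≤ A) (hx_nonneg : ∀ s, 0 ≤ x s)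
    (hx_le : ∀ s, x s ≤ B) (T : ℕ) :
    ∑ s ∈ Finset.range T, x s ≤ A + B +
      ∑ s ∈ Finset.range T, if A < ∑ j ∈ Finset.range s, x j then x s else 0 := by
  have above_nonneg : ∀ T, 0 ≤ ∑ s ∈ Finset.range T,
      if A < ∑ j ∈ Finset.range s, x j then x s else 0 := fun T ↦
    Finset.sum_nonneg fun s _ ↦ ite_nonneg (hx_nonneg s) le_rfl
  induction T with
  | zero => simpa using add_nonneg hA ((hx_nonneg 0).trans (hx_le 0))
  | succ T ih =>
    by_cases h : A < ∑ j ∈ Finset.range T, x j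
    · rw [Finset.sum_range_succ, Finset.sum_range_succ, if_pos h]
      linarith
    · rw [Finset.sum_range_succ x]
      linarith [hx_le T, above_nonneg (T + 1)]

section SelCount

variable {M N : ℕ} {a : ℕ → Fin M → Fin N}

theorem sum_ite_selected_le (b : Fin M → Fin N) (i : Fin N) :
    ∑ d, (if b d = i then (1 : ℝ) else 0) ≤ M :=
  (Finset.sum_le_sum fun d _ ↦ (ite_one_zero_mem_Icc (b d = i)).2).trans (by simp)

theorem selCount_nonneg (a : ℕ → Fin M → Fin N) (i : Fin N) (T : ℕ) : 0 ≤ selCount a i T :=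
  Finset.sum_nonneg fun _ _ ↦ Finset.sum_nonneg fun _ _ ↦ (ite_one_zero_mem_Icc _).1

theorem selCount_le_mul (a : ℕ → Fin M → Fin N) (i : Fin N) (T : ℕ) : selCount a i T ≤ T * M :=
  (Finset.sum_le_sum fun s _ ↦ sum_ite_selected_le (a (s + 1)) i).trans (by simp)

theorem selCount_val_eq_zero (hinit : ∀ (i : Fin N) (k : Fin M), a (i.val + 1) k = i)
    (i : Fin N) : selCount a i i.val = 0 := by
  refine Finset.sum_eq_zero fun s hs ↦ Finset.sum_eq_zero fun d _ ↦ if_neg ?_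
  have hs_lt : s < i.val := Finset.mem_range.mp hs
  rw [hinit ⟨s, hs_lt.trans i.isLt⟩ d, Fin.ext_iff]
  exact hs_lt.ne

theorem selCount_le_add_sum_above (hinit : ∀ (i : Fin N) (k : Fin M), a (i.val + 1) k = i)
    (i : Fin N) {A : ℝ} (hA : 0 ≤ A) (T : ℕ) :
    selCount a i T ≤ A + M + ∑ s ∈ Finset.Ico N T, ∑ d,
      if a (s + 1) d = i ∧ A < selCount a i s then 1 else 0 := by
  refine (sum_range_le_add_sum_above hA
    (fun s ↦ Finset.sum_nonneg fun d _ ↦ (ite_one_zero_mem_Icc (a (s + 1) d = i)).1)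
    (fun s ↦ sum_ite_selected_le (a (s + 1)) i) T).trans (add_le_add le_rfl (le_of_eq ?_))
  have init_zero : ∀ s < N, (∑ d, if a (s + 1) d = i ∧ A < selCount a i s then (1 : ℝ) else 0)
      = 0 := fun s hs ↦ Finset.sum_eq_zero fun d _ ↦ if_neg fun ⟨hsel, hlt⟩ ↦ by
    obtain rfl : (⟨s, hs⟩ : Fin N) = i := (hinit ⟨s, hs⟩ d).symm.trans hsel
    exact (selCount_val_eq_zero hinit ⟨s, hs⟩ ▸ hlt).not_ge hA
  calc ∑ s ∈ Finset.range T, (if A < selCount a i s then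
          ∑ d, (if a (s + 1) d = i then (1 : ℝ) else 0) else 0)
      = ∑ s ∈ Finset.range T, ∑ d, if a (s + 1) d = i ∧ A < selCount a i s then 1 else 0 :=
        Finset.sum_congr rfl fun s _ ↦ by split_ifs with h <;> simp [h]
    _ = ∑ s ∈ Finset.Ico N T, ∑ d, if a (s + 1) d = i ∧ A < selCount a i s then 1 else 0 := by
        refine (Finset.sum_subset (fun s hs ↦ ?_) fun s hsT hs ↦ init_zero s ?_).symm
        · exact Finset.mem_range.mpr (Finset.mem_Ico.mp hs).2
        · exact not_le.mp fun hNs ↦ hs (Finset.mem_Ico.mpr ⟨hNs, Finset.mem_range.mp hsT⟩)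

end SelCount

section Expectation

variable {M N : ℕ} {Ω : Type*} [MeasurableSpace Ω] {μ : Measure Ω}
  {arm : ℕ → Fin M → Ω → Fin N}

theorem integrable_selCount [IsFiniteMeasure μ] (harm : ∀ s d, Measurable (arm (s + 1) d))
    (i : Fin N) (T : ℕ) : Integrable (fun ω ↦ selCount (armsAt arm ω) i T) μ :=
  Integrable.of_bound (measurable_selCount harm i T).aestronglyMeasurable (T * M)
    (ae_of_all _ fun ω ↦ by
      rw [Real.norm_of_nonneg (selCount_nonneg _ _ _)]
      exact selCount_le_mul _ _ _)

theorem integral_selCount_le_add_sum_measureReal [IsProbabilityMeasure μ]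
    (harm : ∀ s d, Measurable (arm (s + 1) d))
    (hinit : ∀ (i : Fin N) (k : Fin M) (ω : Ω), arm (i.val + 1) k ω = i) (i : Fin N) {A : ℝ}
    (hA : 0 ≤ A) (T : ℕ) :
    ∫ ω, selCount (armsAt arm ω) i T ∂μ ≤ A + M + ∑ k, ∑ s ∈ Finset.Ico N T,
      μ.real {ω | arm (s + 1) k ω = i ∧ A < selCount (armsAt arm ω) i s} := by
  set late : ℕ → Fin M → Set Ω := fun s k ↦
    {ω | arm (s + 1) k ω = i ∧ A < selCount (armsAt arm ω) i s}
  have late_measurable : ∀ s k, MeasurableSet (late s k) := fun s k ↦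
    (harm s k (MeasurableSet.singleton i)).inter
      (measurableSet_lt measurable_const (measurable_selCount harm i s))
  have late_integrable : ∀ s k, Integrable ((late s k).indicator (1 : Ω → ℝ)) μ := fun s k ↦
    (integrable_const 1).indicator (late_measurable s k)
  have sum_integrable : Integrable (fun ω ↦ ∑ s ∈ Finset.Ico N T, ∑ k,
      (late s k).indicator (1 : Ω → ℝ) ω) μ :=
    integrable_finsetSum _ fun s _ ↦ integrable_finsetSum _ fun k _ ↦ late_integrable s k
  calc ∫ ω, selCount (armsAt arm ω) i T ∂μ
      ≤ ∫ ω, (A + M + ∑ s ∈ Finset.Ico N T, ∑ k, (late s k).indicator (1 : Ω → ℝ) ω) ∂μ := by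
        refine integral_mono (integrable_selCount harm i T)
          ((integrable_const _).add sum_integrable) fun ω ↦ ?_
        simpa only [late, Set.indicator_apply, Set.mem_ofPred_eq, Pi.one_apply] using
          selCount_le_add_sum_above (a := armsAt arm ω) (fun i k ↦ hinit i k ω) i hA T
    _ = A + M + ∑ s ∈ Finset.Ico N T, ∑ k, μ.real (late s k) := by
        rw [integral_add (integrable_const _) sum_integrable, integral_const, probReal_univ,
          one_smul, integral_finsetSum _ fun s _ ↦ integrable_finsetSum _ fun k _ ↦
            late_integrable s k]
        simp only [integral_finsetSum _ fun k _ ↦ late_integrable _ k,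
          integral_indicator_one (late_measurable _ _)]
    _ = A + M + ∑ k, ∑ s ∈ Finset.Ico N T, μ.real (late s k) := by rw [Finset.sum_comm]

theorem add_sum_reachTime_le_constL {γ η : ℝ} (hγ : 1 < γ) (hη : 0 < η) {ε : ℝ} (hε : 0 ≤ ε)
    (f : ℝ → ℝ) (εc : Fin M → ℝ) (n : ℕ) :
    M * (1 + ε) + ∑ k, (reachTime f (εc k) - 1 +
      2 * ∑ s ∈ Finset.Ico 1 n, deviationBound γ η s) ≤ constL γ η f ε εc := by
  have log_pos : 0 < Real.log (1 + η) := Real.log_pos (by linarith)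
  have log_le : Real.log (1 + η) ≤ Real.log ((1 + ε) * (1 + η)) :=
    Real.log_le_log (by linarith) (by nlinarith)
  have : 0 < γ - 1 := sub_pos.mpr hγ
  have sum_le : 2 * M * ∑ s ∈ Finset.Ico 1 n, deviationBound γ η s ≤ 2 * M / Real.log (1 + η) *
      (1 / (γ - 1) ^ 2 + γ * Real.log ((1 + ε) * (1 + η)) / (γ - 1) + 1) := by
    rw [div_mul_eq_mul_div, ← mul_div_assoc']
    refine mul_le_mul_of_nonneg_left ((sum_deviationBound_le hγ hη n).trans ?_) (by positivity)
    gcongr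
  rw [Finset.sum_add_distrib, Finset.sum_const, Finset.card_univ, Fintype.card_fin, nsmul_eq_mul,
    constL]
  linarith

variable [IsProbabilityMeasure μ] {P : Matrix (Fin M) (Fin M) ℝ} {lam : Fin M → ℝ}
  {u : Fin M → Fin M → ℝ} {σ γ η : ℝ} {f : ℝ → ℝ} {p : Fin N → Measure ℝ} {m : Fin N → ℝ}
  {r : ℕ → Fin M → Fin N → Ω → ℝ} {i : Fin N}

theorem IsCoopUCB2.integral_selCount_le (h : IsCoopUCB2 P σ γ η f r arm) (hP : IsMixing P lam u)
    (hr : IsRewardProcess μ p r) (hp : ∀ i, IsSubGaussian (p i) σ)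
    (hm : ∀ i, m i = ∫ x, x ∂(p i)) (hσ : 0 < σ) (hγ : 1 < γ) (hη : η ∈ Set.Ioo (0 : ℝ) 4)
    (hf_nonneg : ∀ t, 1 ≤ t → 0 ≤ f t) (hf : MonotoneOn f (Set.Ici 1))
    (hreach : ∀ k, ∃ t, 1 ≤ t ∧ epsC lam u k ≤ f t) (hi : 0 < gap m i) (T : ℕ) :
    ∫ ω, selCount (armsAt arm ω) i T ∂μ ≤
      selThreshold M σ γ η f T (gap m i) + constL γ η f (epsN lam) (epsC lam u) := by
  have hγ_pos : 0 < γ := one_pos.trans hγ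
  have threshold_nonneg : 0 ≤ selThreshold M σ γ η f T (gap m i) + M * epsN lam :=
    add_nonneg (selThreshold_nonneg hγ_pos.le (gFun_pos hη).le T)
      (mul_nonneg (Nat.cast_nonneg M) hP.epsN_nonneg)
  have sum_agent_le := fun k ↦ sum_le_reachTime_add_sum_deviationBound hη.1.le hf (hreach k) i.pos T
    (b := fun s ↦ μ.real {ω | arm (s + 1) k ω = i ∧ selThreshold M σ γ η f T (gap m i) +
      M * epsN lam < selCount (armsAt arm ω) i s})
    (fun s ↦ measureReal_le_one) fun s hs hk ↦ h.measureReal_selected_le hP hr hp hm hσ hγ_pos hη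
      hf_nonneg hf hi (Finset.mem_Ico.mp hs).1 (Finset.mem_Ico.mp hs).2 hk
  have integral_le := integral_selCount_le_add_sum_measureReal (μ := μ) (h.measurable hr) h.init i
    threshold_nonneg T
  have constants_le := add_sum_reachTime_le_constL hγ hη.1 hP.epsN_nonneg f (epsC lam u) T
  linarith [Finset.sum_le_sum fun k (_ : k ∈ Finset.univ) ↦ sum_agent_le k]

end Expectation

/-! ### Regret -/

theorem gap_nonneg {N : ℕ} (m : Fin N → ℝ) (i : Fin N) : 0 ≤ gap m i :=
  sub_nonneg.mpr (le_ciSup (Set.finite_range m).bddAbove i)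

section RegretDecomposition

variable {M N : ℕ} {Ω : Type*} [MeasurableSpace Ω] {μ : Measure Ω} [IsProbabilityMeasure μ]
  {arm : ℕ → Fin M → Ω → Fin N}

theorem regret_eq_sum_gap_mul_selCount (m : Fin N → ℝ) (a : ℕ → Fin M → Fin N) (T : ℕ) :
    (M : ℝ) * T * (⨆ j, m j) - ∑ t ∈ Finset.Icc 1 T, ∑ k, m (a t k) =
      ∑ i, gap m i * selCount a i T := by
  have best_eq : (M : ℝ) * T * (⨆ j, m j) = ∑ _s ∈ Finset.range T, ∑ _k : Fin M, ⨆ j, m j := by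
    simp only [Finset.sum_const, Finset.card_univ, Fintype.card_fin, Finset.card_range,
      nsmul_eq_mul]
    ring
  have shift : ∑ t ∈ Finset.Icc 1 T, ∑ k, m (a t k) =
      ∑ s ∈ Finset.range T, ∑ k, m (a (s + 1) k) := by
    rw [Finset.range_eq_Ico, Finset.sum_Ico_add' (fun t ↦ ∑ k, m (a t k)) 0 T 1]
    rfl
  calc (M : ℝ) * T * (⨆ j, m j) - ∑ t ∈ Finset.Icc 1 T, ∑ k, m (a t k)
      = ∑ s ∈ Finset.range T, ∑ k, gap m (a (s + 1) k) := by
        simp only [best_eq, shift, gap, Finset.sum_sub_distrib]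
    _ = ∑ s ∈ Finset.range T, ∑ k, ∑ i, gap m i * (if a (s + 1) k = i then 1 else 0) := by
        simp only [mul_ite, mul_one, mul_zero, Finset.sum_ite_eq, Finset.mem_univ, if_true]
    _ = ∑ i, gap m i * selCount a i T := by
        simp only [selCount, Finset.mul_sum]
        exact (Finset.sum_comm.trans (Finset.sum_congr rfl fun s _ ↦ Finset.sum_comm)).symm

theorem regretUnc_eq_sum_gap_mul_integral (m : Fin N → ℝ)
    (harm : ∀ s d, Measurable (arm (s + 1) d)) (T : ℕ) :
    regretUnc μ m arm T = ∑ i, gap m i * ∫ ω, selCount (armsAt arm ω) i T ∂μ := by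
  have gap_selCount_integrable : ∀ i,
      Integrable (fun ω ↦ gap m i * selCount (armsAt arm ω) i T) μ :=
    fun i ↦ (integrable_selCount harm i T).const_mul _
  have reward_eq : ∀ ω, ∑ t ∈ Finset.Icc 1 T, ∑ k, m (arm t k ω) =
      (M : ℝ) * T * (⨆ j, m j) - ∑ i, gap m i * selCount (armsAt arm ω) i T := fun ω ↦ by
    rw [← regret_eq_sum_gap_mul_selCount, sub_sub_cancel]
  simp only [regretUnc, reward_eq]
  rw [integral_sub (integrable_const _)
      (integrable_finsetSum _ fun i _ ↦ gap_selCount_integrable i),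
    integral_finsetSum _ fun i _ ↦ gap_selCount_integrable i]
  simp [integral_const_mul]

theorem regretUnc_nonneg (m : Fin N → ℝ) (harm : ∀ s d, Measurable (arm (s + 1) d)) (T : ℕ) :
    0 ≤ regretUnc μ m arm T := by
  rw [regretUnc_eq_sum_gap_mul_integral m harm]
  exact Finset.sum_nonneg fun i _ ↦ mul_nonneg (gap_nonneg m i)
    (integral_nonneg fun ω ↦ selCount_nonneg _ _ _)

end RegretDecomposition

section RegretBound

variable {M N : ℕ} {σ γ η : ℝ} {f : ℝ → ℝ} {lam : Fin M → ℝ} {u : Fin M → Fin M → ℝ}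
  {m : Fin N → ℝ}

/-- The bound on the regret until time `T`. At `T = 1` the first sum vanishes, as `log 1 = 0`. -/
noncomputable def regretBound (σ γ η : ℝ) (f : ℝ → ℝ) (lam : Fin M → ℝ) (u : Fin M → Fin M → ℝ)
    (m : Fin N → ℝ) (T : ℕ) : ℝ :=
  ∑ i with 0 < gap m i, 4 * σ ^ 2 * γ * Real.log T / (gap m i * gFun η) *
    (1 + √(1 + gap m i ^ 2 * M * gFun η / (2 * γ * σ ^ 2) * (f T / Real.log T)))
  + ∑ i, constL γ η f (epsN lam) (epsC lam u) * gap m i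

/-- The limit of the regret bound divided by `log T`. It depends on neither the graph nor the
number of agents. -/
noncomputable def leadingCoef (σ γ η : ℝ) (m : Fin N → ℝ) : ℝ :=
  ∑ i with 0 < gap m i, 8 * σ ^ 2 * γ / (gap m i * gFun η)

theorem sum_gap_mul_le_regretBound {T : ℕ} {c : Fin N → ℝ}
    (hc : ∀ i, 0 < gap m i → c i ≤
      selThreshold M σ γ η f T (gap m i) + constL γ η f (epsN lam) (epsC lam u)) :
    ∑ i, gap m i * c i ≤ regretBound σ γ η f lam u m T := by
  rw [regretBound, Finset.sum_filter, ← Finset.sum_add_distrib]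
  refine Finset.sum_le_sum fun i _ ↦ ?_
  split_ifs with hi
  · refine (mul_le_mul_of_nonneg_left (hc i hi) hi.le).trans_eq ?_
    rw [selThreshold]
    field_simp
  · simp [le_antisymm (not_lt.mp hi) (gap_nonneg m i)]

theorem tendsto_regretBound_div_log (hf : f =o[atTop] Real.log) :
    Tendsto (fun T : ℕ ↦ regretBound σ γ η f lam u m T / Real.log T) atTop
      (𝓝 (leadingCoef σ γ η m)) := by
  have log_tendsto : Tendsto (fun T : ℕ ↦ Real.log T) atTop atTop :=
    Real.tendsto_log_atTop.comp tendsto_natCast_atTop_atTop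
  have ratio_tendsto : Tendsto (fun T : ℕ ↦ f T / Real.log T) atTop (𝓝 0) :=
    hf.tendsto_div_nhds_zero.comp tendsto_natCast_atTop_atTop
  have term_tendsto : ∀ a b : ℝ,
      Tendsto (fun T : ℕ ↦ a * (1 + √(1 + b * (f T / Real.log T)))) atTop (𝓝 (2 * a)) :=
    fun a b ↦ by
      convert (((ratio_tendsto.const_mul b).const_add 1).sqrt.const_add 1).const_mul a using 2
      rw [mul_zero, add_zero, Real.sqrt_one]
      ring
  have sum_tendsto := (tendsto_finsetSum (Finset.univ.filter fun i ↦ 0 < gap m i) fun i _ ↦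
      term_tendsto (4 * σ ^ 2 * γ / (gap m i * gFun η))
        (gap m i ^ 2 * M * gFun η / (2 * γ * σ ^ 2))).add
    (log_tendsto.const_div_atTop (∑ i, constL γ η f (epsN lam) (epsC lam u) * gap m i))
  have limit_eq : ∑ i with 0 < gap m i, 2 * (4 * σ ^ 2 * γ / (gap m i * gFun η)) + 0 =
      leadingCoef σ γ η m := by
    rw [add_zero, leadingCoef]
    exact Finset.sum_congr rfl fun i _ ↦ by ring
  rw [limit_eq] at sum_tendsto
  refine sum_tendsto.congr' ?_
  filter_upwards [log_tendsto.eventually_gt_atTop 0] with T log_pos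
  rw [regretBound, add_div]
  congr 1
  rw [Finset.sum_div]
  refine Finset.sum_congr rfl fun i _ ↦ ?_
  field_simp

theorem regretBound_eventually_le (hf : f =o[atTop] Real.log) {δ : ℝ} (hδ : 0 < δ) :
    ∀ᶠ T : ℕ in atTop,
      regretBound σ γ η f lam u m T ≤ (leadingCoef σ γ η m + δ) * Real.log T := by
  filter_upwards [(tendsto_regretBound_div_log hf).eventually_lt_const
    (lt_add_of_pos_right (leadingCoef σ γ η m) hδ), eventually_gt_atTop 1] with T hT one_lt_T
  exact (div_le_iff₀ (Real.log_pos (Nat.one_lt_cast.mpr one_lt_T))).mp hT.le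

variable {Ω : Type*} [MeasurableSpace Ω] {μ : Measure Ω} [IsProbabilityMeasure μ]
  {P : Matrix (Fin M) (Fin M) ℝ} {p : Fin N → Measure ℝ} {r : ℕ → Fin M → Fin N → Ω → ℝ}
  {arm : ℕ → Fin M → Ω → Fin N}

theorem IsCoopUCB2.regretUnc_le_regretBound (h : IsCoopUCB2 P σ γ η f r arm)
    (hP : IsMixing P lam u) (hr : IsRewardProcess μ p r) (hp : ∀ i, IsSubGaussian (p i) σ)
    (hm : ∀ i, m i = ∫ x, x ∂(p i)) (hσ : 0 < σ) (hγ : 1 < γ) (hη : η ∈ Set.Ioo (0 : ℝ) 4)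
    (hf_nonneg : ∀ t, 1 ≤ t → 0 ≤ f t) (hf : MonotoneOn f (Set.Ici 1))
    (hreach : ∀ k, ∃ t, 1 ≤ t ∧ epsC lam u k ≤ f t) (T : ℕ) :
    regretUnc μ m arm T ≤ regretBound σ γ η f lam u m T := by
  rw [regretUnc_eq_sum_gap_mul_integral m (h.measurable hr)]
  exact sum_gap_mul_le_regretBound fun i hi ↦
    h.integral_selCount_le hP hr hp hm hσ hγ hη hf_nonneg hf hreach hi T

end RegretBound

end CoopUCB

theorem corollary1_general {M N : ℕ} (P : Matrix (Fin M) (Fin M) ℝ)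
    (lam : Fin M → ℝ) (u : Fin M → Fin M → ℝ) (hP : CoopUCB.IsMixing P lam u)
    (σ γ η : ℝ) (hσ : 0 < σ) (hγ : 1 < γ) (hη : η ∈ Set.Ioo (0 : ℝ) 4)
    (f : ℝ → ℝ) (hf_nonneg : ∀ t, 1 ≤ t → 0 ≤ f t) (hf_mono : MonotoneOn f (Set.Ici 1))
    (hf_sublog : f =o[atTop] Real.log)
    (hf_reach : ∀ k, ∃ t, 1 ≤ t ∧ CoopUCB.epsC lam u k ≤ f t)
    {Ω : Type*} [MeasurableSpace Ω] (μ : Measure Ω) [IsProbabilityMeasure μ]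
    (p : Fin N → Measure ℝ) (hp : ∀ i, CoopUCB.IsSubGaussian (p i) σ)
    (m : Fin N → ℝ) (hm : ∀ i, m i = ∫ x, x ∂(p i))
    (r : ℕ → Fin M → Fin N → Ω → ℝ) (hr : CoopUCB.IsRewardProcess μ p r)
    (arm : ℕ → Fin M → Ω → Fin N)
    (harm : CoopUCB.IsCoopUCB2 P σ γ η f r arm) :
    (∀ T : ℕ, 1 ≤ T →
      CoopUCB.regretUnc μ m arm T ≤
        ∑ i with 0 < CoopUCB.gap m i,
          4 * σ ^ 2 * γ * Real.log T / (CoopUCB.gap m i * CoopUCB.gFun η) *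
            (1 + √(1 + CoopUCB.gap m i ^ 2 * M * CoopUCB.gFun η / (2 * γ * σ ^ 2)
              * (f T / Real.log T)))
        + ∑ i, CoopUCB.constL γ η f (CoopUCB.epsN lam) (CoopUCB.epsC lam u) * CoopUCB.gap m i) ∧
    ((fun T : ℕ => CoopUCB.regretUnc μ m arm T) =O[atTop] fun T : ℕ => Real.log T) ∧
    (∀ δ : ℝ, 0 < δ → ∀ᶠ T : ℕ in atTop,
      CoopUCB.regretUnc μ m arm T ≤
        (∑ i with 0 < CoopUCB.gap m i,
          8 * σ ^ 2 * γ / (CoopUCB.gap m i * CoopUCB.gFun η) + δ) * Real.log T) := by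
  have regret_le : ∀ T, CoopUCB.regretUnc μ m arm T ≤ CoopUCB.regretBound σ γ η f lam u m T :=
    harm.regretUnc_le_regretBound hP hr hp hm hσ hγ hη hf_nonneg hf_mono hf_reach
  have regret_eventually_le : ∀ δ : ℝ, 0 < δ → ∀ᶠ T : ℕ in atTop,
      CoopUCB.regretUnc μ m arm T ≤ (CoopUCB.leadingCoef σ γ η m + δ) * Real.log T :=
    fun δ hδ ↦ (CoopUCB.regretBound_eventually_le hf_sublog hδ).mono fun T hT ↦
      (regret_le T).trans hT
  refine ⟨fun T _ ↦ regret_le T, ?_, regret_eventually_le⟩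
  refine IsBigO.of_bound (CoopUCB.leadingCoef σ γ η m + 1) ?_
  filter_upwards [regret_eventually_le 1 one_pos] with T hT
  rwa [Real.norm_of_nonneg (CoopUCB.regretUnc_nonneg m (harm.measurable hr) T),
    Real.norm_of_nonneg (Real.log_natCast_nonneg T)]

theorem corollary1 {M N : ℕ} (G : SimpleGraph (Fin M)) [DecidableRel G.Adj] (hG : G.Connected)
    (κ : ℝ) (hκ : κ ∈ Set.Ioc (0 : ℝ) 1)
    (lam : Fin M → ℝ) (u : Fin M → Fin M → ℝ)
    (hlam : CoopUCB.IsOrderedEigenbasis (CoopUCB.consensusMatrix G κ) lam u)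
    (hlam_gt : ∀ p, -1 < lam p)
    (σ γ η : ℝ) (hσ : 0 < σ) (hγ : 1 < γ) (hη : η ∈ Set.Ioo (0 : ℝ) 4)
    (f : ℝ → ℝ) (hf_nonneg : ∀ t, 1 ≤ t → 0 ≤ f t) (hf_mono : MonotoneOn f (Set.Ici 1))
    (hf_sublog : f =o[atTop] Real.log)
    (hf_reach : ∀ k, ∃ t, 1 ≤ t ∧ CoopUCB.epsC lam u k ≤ f t)
    {Ω : Type*} [MeasurableSpace Ω] (μ : Measure Ω) [IsProbabilityMeasure μ]
    (p : Fin N → Measure ℝ) (hp : ∀ i, CoopUCB.IsSubGaussian (p i) σ)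
    (m : Fin N → ℝ) (hm : ∀ i, m i = ∫ x, x ∂(p i))
    (r : ℕ → Fin M → Fin N → Ω → ℝ) (hr : CoopUCB.IsRewardProcess μ p r)
    (arm : ℕ → Fin M → Ω → Fin N)
    (harm : CoopUCB.IsCoopUCB2 (CoopUCB.consensusMatrix G κ) σ γ η f r arm) :
    (∀ T : ℕ, 1 ≤ T →
      CoopUCB.regretUnc μ m arm T ≤
        ∑ i with 0 < CoopUCB.gap m i,
          4 * σ ^ 2 * γ * Real.log T / (CoopUCB.gap m i * CoopUCB.gFun η) *
            (1 + √(1 + CoopUCB.gap m i ^ 2 * M * CoopUCB.gFun η / (2 * γ * σ ^ 2)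
              * (f T / Real.log T)))
        + ∑ i, CoopUCB.constL γ η f (CoopUCB.epsN lam) (CoopUCB.epsC lam u) * CoopUCB.gap m i) ∧
    ((fun T : ℕ => CoopUCB.regretUnc μ m arm T) =O[atTop] fun T : ℕ => Real.log T) ∧
    (∀ δ : ℝ, 0 < δ → ∀ᶠ T : ℕ in atTop,
      CoopUCB.regretUnc μ m arm T ≤
        (∑ i with 0 < CoopUCB.gap m i,
          8 * σ ^ 2 * γ / (CoopUCB.gap m i * CoopUCB.gFun η) + δ) * Real.log T) :=
  corollary1_general _ lam u (CoopUCB.isMixing_consensusMatrix hG hκ hlam hlam_gt) σ γ η hσ hγ hη f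
    hf_nonneg hf_mono hf_sublog hf_reach μ p hp m hm r hr arm harm
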